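/- Let $H=\begin{pmatrix} a & b\\ c & d_0\end{pmatrix}\in U(2)$ with $a\,b\,c\,d_0\neq 0$. On $\ell^2(\mathbb Z)\otimes\mathbb C^2$, where $\mathbb C^2$ has orthonormal basis $|L\rangle,|R\rangle$ (in this order), put $U=S(I\otimes H)$, where $S|x\rangle|L\rangle=|x-1\rangle|L\rangle$ and $S|x\rangle|R\rangle=|x+1\rangle|R\rangle$, and let $\rho_0=\tfrac12(|L\rangle\langle L|+|R\rangle\langle R|)$. For $d\in\mathbb N$ let $p_d(x)=\operatorname{Tr}\bigl[\bigl(\operatorname{Tr}_c\,U^d(|0\rangle\langle 0|\otimes\rho_0)U^{d\dagger}\bigr)|x\rangle\langle x|\bigr]$, $x\in\mathbb Z$, be the distribution of the measured position of the walk after $d$ steps, where $\operatorname{Tr}_c$ is the partial trace over the coin $\mathbb C^2$. Let $\beta\in[0,1]$. Let the final time $t$ tend to infinity along a sequence of natural numbers of the form $t=dM$, where the number $d=d(t)$ of steps between measurements and the number $M=M(t)$ of measurements are natural numbers and $d\sim t^{\beta}$ (that is, $d/t^{\beta}\to 1$). Let $X_t=Y^{(d)}_1+\dots+Y^{(d)}_M$,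 where $Y^{(d)}_1,\dots,Y^{(d)}_M$ are i.i.d. with $\Pr(Y^{(d)}_i=x)=p_d(x)$ for $x\in\mathbb Z$ (the position is measured every $d$ steps, and the coin is then re-prepared in the state $\rho_0$). Then, as $t\to\infty$, in distribution, $$\frac{X_t}{t^{(1+\beta)/2}}\Rightarrow\begin{cases}N(0,1) & \text{if }\beta=0,\\ N\bigl(0,\,1-\sqrt{1-|a|^2}\bigr) & \text{if }0<\beta<1,\\ K(|a|) & \text{if }\beta=1,\end{cases}$$ where $N(m,\sigma^2)$ is the normal law with mean $m$ and variance $\sigma^2$ and, for $0<r<1$, $K(r)$ is the probability law on $\mathbb R$ with density $\dfrac{\sqrt{1-r^2}}{\pi(1-x^2)\sqrt{r^2-x^2}}$ on $(-r,r)$ and $0$ elsewhere. -/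

import Mathlib

open MeasureTheory ProbabilityTheory Filter Topology
open scoped InnerProductSpace Asymptotics

/-- The position space `ℓ²(ℤ)`. -/
abbrev PosSpace : Type := lp (fun _ : ℤ => ℂ) 2

/-- The space of the walker, `ℓ²(ℤ) ⊗ ℂ² = ℓ²(ℤ × {L, R})`. The coin basis is `L = 0`, `R = 1`. -/
abbrev WalkSpace : Type := lp (fun _ : ℤ × Fin 2 => ℂ) 2

/-- The position basis vector `|x⟩`. -/
noncomputable def posKet (x : ℤ) : PosSpace := lp.single 2 x 1

/-- The basis vector `|x⟩ ⊗ |c⟩`. -/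
noncomputable def walkKet (x : ℤ) (c : Fin 2) : WalkSpace := lp.single 2 (x, c) 1

theorem orthonormal_single_comp {κ ι : Type} [DecidableEq ι] (f : κ → ι)
    (hf : Function.Injective f) :
    Orthonormal ℂ (fun k : κ => (lp.single 2 (f k) 1 : lp (fun _ : ι => ℂ) 2)) := by
  classical
  rw [orthonormal_iff_ite]
  intro i j
  rw [lp.inner_single_left, lp.single_apply]
  by_cases h : i = j
  · subst h; simp
  · simp [h, hf.ne h]

/-- The linear isometry `ℓ²(κ) → ℓ²(ι)` with `|k⟩ ↦ |f k⟩`, for an injective map `f`. -/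
noncomputable def basisMap {κ ι : Type} [DecidableEq ι] (f : κ → ι)
    (hf : Function.Injective f) : lp (fun _ : κ => ℂ) 2 →L[ℂ] lp (fun _ : ι => ℂ) 2 :=
  (orthonormal_single_comp f hf).orthogonalFamily.linearIsometry.toContinuousLinearMap

theorem basisMap_single {κ ι : Type} [DecidableEq κ] [DecidableEq ι] (f : κ → ι)
    (hf : Function.Injective f) (k : κ) :
    basisMap f hf (lp.single 2 k 1) = lp.single 2 (f k) 1 := by
  refine ((orthonormal_single_comp f hf).orthogonalFamily.linearIsometry_apply_single
    (i := k) (1 : ℂ)).trans ?_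
  simp

theorem injective_coin (c : Fin 2) : Function.Injective (fun x : ℤ => (x, c)) :=
  fun _ _ h => (Prod.ext_iff.mp h).1

/-- The embedding `ψ ↦ ψ ⊗ |c⟩`, i.e. `|x⟩ ↦ |x⟩ ⊗ |c⟩`; its adjoint is `I ⊗ ⟨c|`. -/
noncomputable def tensorCoin (c : Fin 2) : PosSpace →L[ℂ] WalkSpace :=
  basisMap (fun x : ℤ => (x, c)) (injective_coin c)

/-- `I ⊗ A = ∑ A i j (I ⊗ |i⟩⟨j|)` for a `2 × 2` matrix `A` acting on the coin. -/
noncomputable def coinOp (A : Matrix (Fin 2) (Fin 2) ℂ) : WalkSpace →L[ℂ] WalkSpace :=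
  ∑ i, ∑ j, A i j • (tensorCoin i ∘L ContinuousLinearMap.adjoint (tensorCoin j))

/-- The displacement caused by a coin state: `-1` for `L`, `+1` for `R`. -/
def displacement (c : Fin 2) : ℤ := if c = 0 then -1 else 1

theorem injective_displace :
    Function.Injective (fun p : ℤ × Fin 2 => (p.1 + displacement p.2, p.2)) := by
  rintro ⟨x, c⟩ ⟨y, e⟩ h
  obtain ⟨h1, h2⟩ := Prod.ext_iff.mp h
  dsimp only at h1 h2
  subst h2
  exact Prod.ext (add_right_cancel h1) rfl

/-- The shift `S |x⟩|L⟩ = |x-1⟩|L⟩`, `S |x⟩|R⟩ = |x+1⟩|R⟩`. -/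
noncomputable def shiftOp : WalkSpace →L[ℂ] WalkSpace :=
  basisMap (fun p : ℤ × Fin 2 => (p.1 + displacement p.2, p.2)) injective_displace

/-- One step of the walk, `U = S (I ⊗ H)`. -/
noncomputable def walkOp (H : Matrix.unitaryGroup (Fin 2) ℂ) : WalkSpace →L[ℂ] WalkSpace :=
  shiftOp ∘L coinOp H.1

/-- The initial state `|0⟩⟨0| ⊗ ρ₀` with `ρ₀ = (|L⟩⟨L| + |R⟩⟨R|) / 2`. -/
noncomputable def initialState : WalkSpace →L[ℂ] WalkSpace :=
  (1 / 2 : ℂ) • ∑ c, InnerProductSpace.rankOne ℂ (walkKet 0 c) (walkKet 0 c)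

/-- The state after `n` steps, `Uⁿ (|0⟩⟨0| ⊗ ρ₀) (Uⁿ)†`. -/
noncomputable def walkState (H : Matrix.unitaryGroup (Fin 2) ℂ) (n : ℕ) :
    WalkSpace →L[ℂ] WalkSpace :=
  (walkOp H ^ n) ∘L initialState ∘L ContinuousLinearMap.adjoint (walkOp H ^ n)

/-- The partial trace over the coin, `∑ (I ⊗ ⟨c|) A (I ⊗ |c⟩)`. -/
noncomputable def coinTrace (A : WalkSpace →L[ℂ] WalkSpace) : PosSpace →L[ℂ] PosSpace :=
  ∑ c, ContinuousLinearMap.adjoint (tensorCoin c) ∘L A ∘L tensorCoin c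

/-- The trace of an operator on `ℓ²(ℤ)`, computed in the position basis. -/
noncomputable def posTrace (B : PosSpace →L[ℂ] PosSpace) : ℂ :=
  ∑' y, ⟪posKet y, B (posKet y)⟫_ℂ

/-- The probability to find the walker at `x` after `n` steps (Born rule):
`Tr [(Tr_c Uⁿ (|0⟩⟨0| ⊗ ρ₀) (Uⁿ)†) |x⟩⟨x|]`. -/
noncomputable def walkProb (H : Matrix.unitaryGroup (Fin 2) ℂ) (n : ℕ) (x : ℤ) : ℝ :=
  (posTrace (coinTrace (walkState H n) ∘L
    InnerProductSpace.rankOne ℂ (posKet x) (posKet x))).re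

/-- The density of the law `K(r)`. -/
noncomputable def konnoDensity (r x : ℝ) : ℝ :=
  (Set.Ioo (-r) r).indicator
    (fun y => √(1 - r ^ 2) / (Real.pi * (1 - y ^ 2) * √(r ^ 2 - y ^ 2))) x

/-- The law `K(r)` on the real line. -/
noncomputable def konnoLaw (r : ℝ) : Measure ℝ :=
  volume.withDensity (fun x => ENNReal.ofReal (konnoDensity r x))

/-!
In Fourier space the walk multiplies the mode `k` by the unitary matrix
`Û(k) = diag(e^{-ik}, e^{ik}) H`, so the characteristic function of the position after `n` steps is
the average over `k` of the overlap `½ Tr ((Û(k)ⁿ)† Û(k + ξ)ⁿ)`. After a global phase, `Û(k)` lies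
in `SU(2)` and has eigenvalues `e^{±iω(k)}`, where `cos ω(k) = |a| cos (k - α)`. The overlap is
therefore real, which makes the position centred, and for `ξ = s / n` it tends to `cos (s ω'(k))`:
the rescaled position converges to the law of the group velocity `ω'(k)` of a uniformly
distributed `k`. This law is `K(|a|)`, its variance is `1 - √(1 - |a|²)`, and since the rescaled
positions lie in `[-1, 1]` their second moments converge to it.

With measurements every `d` steps, the characteristic function of the sum is an `M`-th power. For
`β = 1` eventually `M = 1`, and the limit is that of the free walk. For `β < 1` each summand is
bounded by `d = o(t^{(1+β)/2})`, so expanding to second order gives a Gaussian limit whose variance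
is the limit of the second moment after `d` steps divided by `d²`; for `β = 0` eventually `d = 1`,
and this is `1`.
-/

section CharacteristicFunctions

open ComplexConjugate

variable {α : Type*} {l : Filter α}

theorem tendsto_one_add_pow_cexp {x : α → ℂ} {M : α → ℕ} {c : ℂ} (hx : Tendsto x l (𝓝 0))
    (hMx : Tendsto (fun n => M n * x n) l (𝓝 c)) :
    Tendsto (fun n => (1 + x n) ^ M n) l (𝓝 (Complex.exp c)) := by
  have hlog : (fun n => Complex.log (1 + x n)) ~[l] x := by
    have h := (hasDerivAt_iff_isLittleO_nhds_zero.1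
      (Complex.hasDerivAt_log Complex.one_mem_slitPlane)).comp_tendsto hx
    simpa [Function.comp_def, Asymptotics.IsEquivalent, Pi.sub_def] using h
  have hMlog : Tendsto (fun n => M n * Complex.log (1 + x n)) l (𝓝 c) :=
    (Asymptotics.IsEquivalent.refl.mul hlog).symm.tendsto_nhds hMx
  have hne : ∀ᶠ n in l, 1 + x n ≠ 0 :=
    (hx.const_add 1).eventually_ne (by simp)
  refine ((Complex.continuous_exp.tendsto c).comp hMlog).congr' ?_
  filter_upwards [hne] with n hn
  rw [Function.comp_apply, Complex.exp_nat_mul, Complex.exp_log hn]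

theorem norm_cexp_mul_I_sub_le {x : ℝ} (hx : |x| ≤ 1) :
    ‖Complex.exp (x * Complex.I) - ((1 - x ^ 2 / 2 : ℝ) + x * Complex.I)‖ ≤ |x| ^ 3 := by
  have hnorm : ‖(x * Complex.I : ℂ)‖ = |x| := by simp
  have h := Complex.exp_bound (x := x * Complex.I) (hnorm.trans_le hx) (n := 3) (by norm_num)
  have htaylor : ∑ m ∈ Finset.range 3, (x * Complex.I : ℂ) ^ m / m.factorial =
      (1 - x ^ 2 / 2 : ℝ) + x * Complex.I := by
    simp only [mul_pow, Finset.sum_range_succ, Finset.range_one, Finset.sum_singleton, pow_zero,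
      Nat.factorial_zero, Nat.factorial_one, Nat.factorial_two, Nat.cast_one, Nat.cast_ofNat,
      Complex.I_sq]
    push_cast
    ring
  rw [hnorm, htaylor] at h
  refine h.trans (mul_le_of_le_one_right (by positivity) ?_)
  norm_num [Nat.factorial]

theorem integrable_cexp_mul_I {μ : Measure ℝ} [IsFiniteMeasure μ] (ξ : ℝ) :
    Integrable (fun x : ℝ => Complex.exp (ξ * x * Complex.I)) μ :=
  Integrable.of_bound (by fun_prop) 1 (.of_forall fun x => by
    rw [← Complex.ofReal_mul, Complex.norm_exp_ofReal_mul_I])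

section Bounded

variable {μ : Measure ℝ} [IsProbabilityMeasure μ] {B ξ : ℝ}

theorem norm_charFun_sub_one_le (hμ : ∀ᵐ x ∂μ, |x| ≤ B) : ‖charFun μ ξ - 1‖ ≤ |ξ| * B := by
  have hsub : charFun μ ξ - 1 = ∫ x, (Complex.exp (ξ * x * Complex.I) - 1) ∂μ := by
    rw [charFun_apply_real, integral_sub (integrable_cexp_mul_I ξ) (integrable_const 1)]
    simp
  rw [hsub]
  refine (norm_integral_le_of_norm_le_const (C := |ξ| * B) ?_).trans_eq (by simp)
  filter_upwards [hμ] with x hx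
  have h := Real.norm_exp_I_mul_ofReal_sub_one_le (x := ξ * x)
  rw [mul_comm Complex.I, Complex.ofReal_mul, Real.norm_eq_abs, abs_mul] at h
  exact h.trans (by gcongr)

theorem norm_charFun_sub_one_sub_le (hμ : ∀ᵐ x ∂μ, |x| ≤ B) (hmean : ∫ x, x ∂μ = 0)
    (hξ : |ξ| * B ≤ 1) :
    ‖charFun μ ξ - (1 - ξ ^ 2 / 2 * ∫ x, x ^ 2 ∂μ : ℝ)‖ ≤ |ξ| ^ 3 * B * ∫ x, x ^ 2 ∂μ := by
  have hint1 : Integrable (fun x : ℝ => x) μ := .of_bound (by fun_prop) B hμ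
  have hint2 : Integrable (fun x : ℝ => x ^ 2) μ :=
    .of_bound (by fun_prop) (B ^ 2) (hμ.mono fun x hx => by
      rw [norm_pow]; exact pow_le_pow_left₀ (norm_nonneg x) hx 2)
  have hreal : Integrable (fun x : ℝ => ((1 - (ξ * x) ^ 2 / 2 : ℝ) : ℂ)) μ := by
    simp only [mul_pow, mul_div_right_comm]
    exact ((integrable_const 1).sub (hint2.const_mul _)).ofReal
  have himag : Integrable (fun x : ℝ => ((ξ * x : ℝ) : ℂ) * Complex.I) μ :=
    (hint1.const_mul ξ).ofReal.mul_const _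
  have hadd : Integrable (fun x : ℝ =>
      ((1 - (ξ * x) ^ 2 / 2 : ℝ) : ℂ) + (ξ * x : ℝ) * Complex.I) μ := hreal.add himag
  have htaylor : ∫ x, (((1 - (ξ * x) ^ 2 / 2 : ℝ) : ℂ) + (ξ * x : ℝ) * Complex.I) ∂μ =
      (1 - ξ ^ 2 / 2 * ∫ x, x ^ 2 ∂μ : ℝ) := by
    have hvar : ∫ x, (1 - (ξ * x) ^ 2 / 2) ∂μ = 1 - ξ ^ 2 / 2 * ∫ x, x ^ 2 ∂μ := by
      simp only [mul_pow, mul_div_right_comm]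
      rw [integral_sub (integrable_const 1) (hint2.const_mul _), integral_const_mul]
      simp
    rw [integral_add hreal himag, integral_complex_ofReal, hvar, integral_mul_const,
      integral_complex_ofReal, integral_const_mul, hmean]
    simp
  rw [charFun_apply_real, ← htaylor, ← integral_sub (integrable_cexp_mul_I ξ) hadd,
    ← integral_const_mul]
  refine norm_integral_le_of_norm_le (hint2.const_mul _) ?_
  filter_upwards [hμ] with x hx
  have hξx : |ξ * x| ≤ |ξ| * B := by rw [abs_mul]; gcongr
  rw [← Complex.ofReal_mul]
  calc _ ≤ |ξ * x| ^ 3 := norm_cexp_mul_I_sub_le (hξx.trans hξ)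
    _ = |ξ| ^ 3 * |x| * x ^ 2 := by rw [abs_mul, ← sq_abs x]; ring
    _ ≤ |ξ| ^ 3 * B * x ^ 2 := by gcongr

end Bounded

theorem tendsto_charFun_pow_gaussianReal {μ : α → Measure ℝ} [∀ n, IsProbabilityMeasure (μ n)]
    {B τ : α → ℝ} {M : α → ℕ} {v : NNReal} (hμ : ∀ n, ∀ᵐ x ∂μ n, |x| ≤ B n)
    (hmean : ∀ n, ∫ x, x ∂μ n = 0) (hB : Tendsto (fun n => B n / τ n) l (𝓝 0))
    (hv : Tendsto (fun n => M n * (∫ x, x ^ 2 ∂μ n) / τ n ^ 2) l (𝓝 v)) (s : ℝ) :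
    Tendsto (fun n => charFun (μ n) (s / τ n) ^ M n) l (𝓝 (charFun (gaussianReal 0 v) s)) := by
  have hB' : Tendsto (fun n => |s / τ n| * B n) l (𝓝 0) := by
    have h := (hB.norm).const_mul |s|
    simp only [norm_zero, mul_zero] at h
    refine squeeze_zero_norm (fun n => le_of_eq ?_) h
    simp only [norm_mul, norm_div, abs_div, Real.norm_eq_abs, abs_abs]
    ring
  have hzero : Tendsto (fun n => charFun (μ n) (s / τ n) - 1) l (𝓝 0) :=
    squeeze_zero_norm (fun n => norm_charFun_sub_one_le (hμ n)) hB'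
  have hlim : Tendsto (fun n => M n * (charFun (μ n) (s / τ n) - 1)) l
      (𝓝 (-(v * s ^ 2 / 2) : ℝ)) := by
    have hmain : Tendsto (fun n =>
        ((-(M n * (∫ x, x ^ 2 ∂μ n) / τ n ^ 2 * s ^ 2 / 2) : ℝ) : ℂ)) l
        (𝓝 (-(v * s ^ 2 / 2) : ℝ)) :=
      (Complex.continuous_ofReal.tendsto _).comp ((hv.mul_const _).div_const _).neg
    have herr : Tendsto (fun n =>
        s ^ 2 * (M n * (∫ x, x ^ 2 ∂μ n) / τ n ^ 2) * (|s / τ n| * B n)) l (𝓝 0) := by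
      simpa using (hv.const_mul (s ^ 2)).mul hB'
    refine tendsto_of_tendsto_of_dist hmain (squeeze_zero_norm' ?_ herr)
    filter_upwards [hB'.eventually_le_const one_pos] with n hn
    have h := norm_charFun_sub_one_sub_le (hμ n) (hmean n) hn
    have hdiff : M n * (charFun (μ n) (s / τ n) - 1) -
        ((-(M n * (∫ x, x ^ 2 ∂μ n) / τ n ^ 2 * s ^ 2 / 2) : ℝ) : ℂ) =
        M n * (charFun (μ n) (s / τ n) - (1 - (s / τ n) ^ 2 / 2 * ∫ x, x ^ 2 ∂μ n : ℝ)) := by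
      push_cast
      ring
    calc ‖dist _ _‖ = M n * ‖charFun (μ n) (s / τ n) -
          (1 - (s / τ n) ^ 2 / 2 * ∫ x, x ^ 2 ∂μ n : ℝ)‖ := by
          rw [dist_comm, dist_eq_norm, norm_norm, hdiff, norm_mul, Complex.norm_natCast]
      _ ≤ M n * (|s / τ n| ^ 3 * B n * ∫ x, x ^ 2 ∂μ n) := by gcongr
      _ = _ := by
          rw [pow_succ, sq_abs, div_pow]
          ring
  have h := tendsto_one_add_pow_cexp hzero hlim
  simp only [add_sub_cancel] at h
  convert! h using 2
  rw [charFun_gaussianReal]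
  push_cast
  congr 1
  ring

theorem integral_id_eq_zero_of_conj_charFun {μ : Measure ℝ} [IsFiniteMeasure μ]
    (hμ : ∀ ξ, conj (charFun μ ξ) = charFun μ ξ) : ∫ x, x ∂μ = 0 := by
  have hsymm : μ.map (-1 * ·) = μ := Measure.ext_of_charFun <| funext fun ξ => by
    rw [charFun_map_mul, neg_one_mul, charFun_neg, hμ]
  have h : ∫ x, x ∂μ = -∫ x, x ∂μ := by
    conv_lhs => rw [← hsymm]
    rw [integral_map (by fun_prop) (by fun_prop), integral_const_mul, neg_one_mul]
  linarith

theorem tendstoInDistribution_sum_div {ι Ω : ℕ → Type*} [∀ n, Fintype (ι n)]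
    [∀ n, MeasurableSpace (Ω n)] {P : ∀ n, Measure (Ω n)} [∀ n, IsProbabilityMeasure (P n)]
    {Y : ∀ n, ι n → Ω n → ℝ} {μ : ℕ → Measure ℝ} (hlaw : ∀ n i, HasLaw (Y n i) (μ n) (P n))
    (hindep : ∀ n, iIndepFun (Y n) (P n)) {τ : ℕ → ℝ} {ν : Measure ℝ} [IsProbabilityMeasure ν]
    (hlim : ∀ s, Tendsto (fun n => charFun (μ n) (s / τ n) ^ Fintype.card (ι n)) atTop
      (𝓝 (charFun ν s))) :
    TendstoInDistribution (fun n ω => (∑ i, Y n i ω) / τ n) atTop id P ν := by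
  have hmeas : ∀ n, AEMeasurable (fun ω => ∑ i, Y n i ω) (P n) := fun n =>
    Finset.aemeasurable_fun_sum _ fun i _ => (hlaw n i).aemeasurable
  refine ⟨fun n => (hmeas n).div_const _, aemeasurable_id,
    ProbabilityMeasure.tendsto_iff_tendsto_charFun.2 fun s => ?_⟩
  simp only [ProbabilityMeasure.coe_mk, Measure.map_id]
  refine (hlim s).congr fun n => ?_
  simp only [div_eq_inv_mul _ (τ n)]
  rw [charFun_map_mul_comp (hmeas n),
    (hindep n).charFun_map_fun_sum_eq_prod fun i => (hlaw n i).aemeasurable]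
  simp [(hlaw n _).map_eq]

theorem tendsto_integral_of_ae_mem_isCompact {E : Type*} [TopologicalSpace E] [T4Space E]
    [MeasurableSpace E] [OpensMeasurableSpace E] {μ : α → ProbabilityMeasure E}
    {ν : ProbabilityMeasure E} (hlim : Tendsto μ l (𝓝 ν)) {K : Set E} (hK : IsCompact K)
    (hμ : ∀ n, ∀ᵐ x ∂(μ n : Measure E), x ∈ K) (hν : ∀ᵐ x ∂(ν : Measure E), x ∈ K)
    {f : E → ℝ} (hf : ContinuousOn f K) :
    Tendsto (fun n => ∫ x, f x ∂(μ n : Measure E)) l (𝓝 (∫ x, f x ∂(ν : Measure E))) := by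
  have : CompactSpace K := isCompact_iff_compactSpace.1 hK
  obtain ⟨g, -, hg⟩ := BoundedContinuousFunction.exists_norm_eq_domRestrict_eq_of_closed
    (.mkOfCompact ⟨K.domRestrict f, hf.domRestrict⟩) hK.isClosed
  have hgf : ∀ {ρ : Measure E}, (∀ᵐ x ∂ρ, x ∈ K) → ∫ x, g x ∂ρ = ∫ x, f x ∂ρ := fun hρ =>
    integral_congr_ae <| hρ.mono fun x hx => DFunLike.congr_fun hg (⟨x, hx⟩ : K)
  have h := ProbabilityMeasure.tendsto_iff_forall_integral_tendsto.1 hlim g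
  simpa only [hgf hν, hgf (hμ _)] using h

end CharacteristicFunctions

section Operators

theorem inner_single_one {ι : Type} [DecidableEq ι] (i : ι) (ψ : lp (fun _ : ι => ℂ) 2) :
    ⟪(lp.single 2 i 1 : lp (fun _ : ι => ℂ) 2), ψ⟫_ℂ = ψ i := by
  rw [lp.inner_single_left]; simp

section BasisMap

variable {κ ι : Type} [DecidableEq ι] (f : κ → ι) (hf : Function.Injective f)

theorem basisMap_apply (ψ : lp (fun _ : κ => ℂ) 2) (k : κ) :
    basisMap f hf ψ (f k) = ψ k := by
  classical
  rw [← inner_single_one, ← basisMap_single f hf, ← inner_single_one k ψ]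
  exact (orthonormal_single_comp f hf).orthogonalFamily.linearIsometry.inner_map_map _ _

theorem basisMap_apply_of_notMem_range (ψ : lp (fun _ : κ => ℂ) 2) {i : ι}
    (hi : i ∉ Set.range f) : basisMap f hf ψ i = 0 := by
  classical
  have hzero : innerSL ℂ (lp.single 2 i 1 : lp (fun _ : ι => ℂ) 2) ∘L basisMap f hf = 0 := by
    refine lp.ext_continuousLinearMap (by simp) fun k => ?_
    ext
    have hne : i ≠ f k := fun h => hi ⟨k, h.symm⟩
    simp [basisMap_single, inner_single_one, lp.single_apply, hne]
  rw [← inner_single_one]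
  exact DFunLike.congr_fun hzero ψ

end BasisMap

theorem tensorCoin_posKet (c : Fin 2) (x : ℤ) : tensorCoin c (posKet x) = walkKet x c :=
  basisMap_single (fun x : ℤ => (x, c)) (injective_coin c) x

theorem adjoint_tensorCoin_apply (c : Fin 2) (ψ : WalkSpace) (x : ℤ) :
    (ContinuousLinearMap.adjoint (tensorCoin c) ψ : PosSpace) x = ψ (x, c) := by
  rw [← inner_single_one, ContinuousLinearMap.adjoint_inner_right, ← inner_single_one]
  exact congrArg (⟪·, ψ⟫_ℂ) (tensorCoin_posKet c x)

theorem tensorCoin_apply (c : Fin 2) (ψ : PosSpace) (x : ℤ) (e : Fin 2) :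
    tensorCoin c ψ (x, e) = if e = c then ψ x else 0 := by
  split_ifs with h
  · subst h
    exact basisMap_apply (fun x : ℤ => (x, e)) (injective_coin e) ψ x
  · refine basisMap_apply_of_notMem_range _ _ _ ?_
    rintro ⟨y, hy⟩
    exact h (Prod.ext_iff.mp hy).2.symm

theorem coinOp_apply (A : Matrix (Fin 2) (Fin 2) ℂ) (ψ : WalkSpace) (x : ℤ) (c : Fin 2) :
    coinOp A ψ (x, c) = ∑ j, A c j * ψ (x, j) := by
  have happly : coinOp A ψ = ∑ i, ∑ j, A i j •
      (tensorCoin i (ContinuousLinearMap.adjoint (tensorCoin j) ψ) : WalkSpace) := by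
    simp only [coinOp, sum_apply, smul_apply, ContinuousLinearMap.comp_apply]
  rw [happly]
  simp only [lp.coeFn_sum, Finset.sum_apply, lp.coeFn_smul, Pi.smul_apply, tensorCoin_apply,
    adjoint_tensorCoin_apply, smul_eq_mul]
  simp

theorem shiftOp_apply (ψ : WalkSpace) (x : ℤ) (c : Fin 2) :
    shiftOp ψ (x, c) = ψ (x - displacement c, c) := by
  have h := basisMap_apply (fun p : ℤ × Fin 2 => (p.1 + displacement p.2, p.2)) injective_displace
    ψ (x - displacement c, c)
  simpa only [shiftOp, sub_add_cancel] using h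

variable (H : Matrix.unitaryGroup (Fin 2) ℂ)

theorem walkOp_apply (ψ : WalkSpace) (x : ℤ) (c : Fin 2) :
    walkOp H ψ (x, c) = ∑ j, H.1 c j * ψ (x - displacement c, j) := by
  rw [walkOp, ContinuousLinearMap.comp_apply, shiftOp_apply, coinOp_apply]

theorem walkState_apply (n : ℕ) (ψ : WalkSpace) :
    walkState H n ψ = (1 / 2 : ℂ) • ∑ e,
      ⟪(walkOp H ^ n) (walkKet 0 e), ψ⟫_ℂ • (walkOp H ^ n) (walkKet 0 e) := by
  simp only [walkState, initialState, ContinuousLinearMap.comp_apply, smul_apply, sum_apply,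
    InnerProductSpace.rankOne_apply, map_smul, map_sum, ContinuousLinearMap.adjoint_inner_right]

theorem posTrace_comp_rankOne_posKet (B : PosSpace →L[ℂ] PosSpace) (x : ℤ) :
    posTrace (B ∘L InnerProductSpace.rankOne ℂ (posKet x) (posKet x)) =
      ⟪posKet x, B (posKet x)⟫_ℂ := by
  rw [posTrace, tsum_eq_single x]
  · simp [posKet]
  · intro y hy
    simp [posKet, inner_single_one, lp.single_apply, hy.symm]

/-- The amplitude `⟨x, c| Uⁿ |0, e⟩`. -/
noncomputable def amplitude (n : ℕ) (x : ℤ) (c e : Fin 2) : ℂ :=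
  (walkOp H ^ n) (walkKet 0 e) (x, c)

theorem amplitude_zero (x : ℤ) (c e : Fin 2) :
    amplitude H 0 x c e = if x = 0 ∧ c = e then 1 else 0 := by
  simp [amplitude, walkKet, lp.single_apply, Pi.single_apply]

theorem amplitude_succ (n : ℕ) (x : ℤ) (c e : Fin 2) :
    amplitude H (n + 1) x c e = ∑ j, H.1 c j * amplitude H n (x - displacement c) j e := by
  rw [amplitude, pow_succ', mul_apply_eq_comp, walkOp_apply]
  rfl

theorem abs_displacement (c : Fin 2) : |displacement c| = 1 := by
  fin_cases c <;> simp [displacement]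

theorem amplitude_eq_zero {n : ℕ} {x : ℤ} (hx : n < |x|) (c e : Fin 2) :
    amplitude H n x c e = 0 := by
  induction n generalizing x c with
  | zero =>
    rw [amplitude_zero, if_neg]
    rintro ⟨rfl, -⟩
    simp at hx
  | succ n ih =>
    rw [amplitude_succ]
    refine Finset.sum_eq_zero fun j _ => ?_
    have habs := abs_sub_abs_le_abs_sub x (displacement c)
    rw [abs_displacement] at habs
    rw [ih (by push_cast at hx; linarith), mul_zero]

theorem walkProb_eq_sum_amplitude (n : ℕ) (x : ℤ) :
    walkProb H n x = (1 / 2) * ∑ c, ∑ e, ‖amplitude H n x c e‖ ^ 2 := by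
  have hborn : ∀ c e, ⟪(walkOp H ^ n) (walkKet 0 e), walkKet x c⟫_ℂ *
      ⟪walkKet x c, (walkOp H ^ n) (walkKet 0 e)⟫_ℂ = ((‖amplitude H n x c e‖ ^ 2 : ℝ) : ℂ) := by
    intro c e
    rw [← inner_conj_symm, walkKet, inner_single_one, Complex.conj_mul', Complex.ofReal_pow]
    rfl
  have hstate : posTrace (coinTrace (walkState H n) ∘L
      InnerProductSpace.rankOne ℂ (posKet x) (posKet x)) =
      (((1 / 2) * ∑ c, ∑ e, ‖amplitude H n x c e‖ ^ 2 : ℝ) : ℂ) := by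
    simp only [posTrace_comp_rankOne_posKet, coinTrace, sum_apply, ContinuousLinearMap.comp_apply,
      inner_sum, ContinuousLinearMap.adjoint_inner_right, tensorCoin_posKet, walkState_apply,
      inner_smul_right, hborn, ← Finset.mul_sum]
    push_cast
    rfl
  rw [walkProb, hstate, Complex.ofReal_re]

theorem walkProb_nonneg (n : ℕ) (x : ℤ) : 0 ≤ walkProb H n x := by
  rw [walkProb_eq_sum_amplitude]
  positivity

theorem walkProb_eq_zero {n : ℕ} {x : ℤ} (hx : n < |x|) : walkProb H n x = 0 := by
  simp [walkProb_eq_sum_amplitude, amplitude_eq_zero H hx]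

end Operators

section Fourier

open ComplexConjugate Matrix

theorem integral_cexp_int_mul_I (m : ℤ) :
    ∫ k in (0 : ℝ)..2 * Real.pi, Complex.exp (m * Complex.I * k) =
      if m = 0 then 2 * (Real.pi : ℂ) else 0 := by
  split_ifs with hm
  · simp [hm]
  · rw [integral_exp_mul_complex (by simpa using hm)]
    have hperiod : (m * Complex.I * ((2 * Real.pi : ℝ) : ℂ)) = m * (2 * Real.pi * Complex.I) := by
      push_cast; ring
    rw [hperiod, Complex.exp_int_mul_two_pi_mul_I]
    simp

theorem integral_conj_trigSum_mul_trigSum (s : Finset ℤ) (a b : ℤ → ℂ) :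
    ∫ k in (0 : ℝ)..2 * Real.pi, conj (∑ x ∈ s, Complex.exp (k * x * Complex.I) * a x) *
        ∑ y ∈ s, Complex.exp (k * y * Complex.I) * b y =
      2 * Real.pi * ∑ x ∈ s, conj (a x) * b x := by
  have hexpand : ∀ k : ℝ, conj (∑ x ∈ s, Complex.exp (k * x * Complex.I) * a x) *
        ∑ y ∈ s, Complex.exp (k * y * Complex.I) * b y =
      ∑ x ∈ s, ∑ y ∈ s, (conj (a x) * b y) *
        Complex.exp (((y - x : ℤ) : ℂ) * Complex.I * k) := by
    intro k
    rw [map_sum, Finset.sum_mul_sum]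
    refine Finset.sum_congr rfl fun x _ => Finset.sum_congr rfl fun y _ => ?_
    have hexp : conj (Complex.exp (k * x * Complex.I)) * Complex.exp (k * y * Complex.I) =
        Complex.exp (((y - x : ℤ) : ℂ) * Complex.I * k) := by
      rw [← Complex.exp_conj, ← Complex.exp_add]
      simp only [map_mul, Complex.conj_ofReal, Complex.conj_I, map_intCast]
      push_cast
      ring_nf
    rw [map_mul, ← hexp]
    ring
  simp only [hexpand]
  rw [intervalIntegral.integral_finsetSum fun x _ =>
    (Continuous.intervalIntegrable (by fun_prop) _ _), Finset.mul_sum]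
  refine Finset.sum_congr rfl fun x hx => ?_
  rw [intervalIntegral.integral_finsetSum fun y _ =>
    (Continuous.intervalIntegrable (by fun_prop) _ _)]
  simp only [intervalIntegral.integral_const_mul, integral_cexp_int_mul_I, sub_eq_zero,
    mul_ite, mul_zero, Finset.sum_ite_eq', if_pos hx]
  ring

/-- The walk operator in Fourier space, `diag(e^{-ik}, e^{ik}) H`. -/
noncomputable def walkSymbol (H : Matrix (Fin 2) (Fin 2) ℂ) (k : ℝ) : Matrix (Fin 2) (Fin 2) ℂ :=
  diagonal (fun c => Complex.exp (k * displacement c * Complex.I)) * H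

theorem continuous_walkSymbol (H : Matrix (Fin 2) (Fin 2) ℂ) : Continuous (walkSymbol H) := by
  unfold walkSymbol
  fun_prop

variable (H : unitaryGroup (Fin 2) ℂ)

theorem hasSum_amplitude (n : ℕ) (c e : Fin 2) (k : ℝ) :
    HasSum (fun x : ℤ => Complex.exp (k * x * Complex.I) * amplitude H n x c e)
      ((walkSymbol H.1 k ^ n) c e) := by
  induction n generalizing c with
  | zero =>
    convert! hasSum_ite_eq (0 : ℤ) ((1 : Matrix (Fin 2) (Fin 2) ℂ) c e) using 2 with x
    by_cases hx : x = 0 <;> simp [amplitude_zero, hx, Matrix.one_apply]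
  | succ n ih =>
    have hsum : HasSum (fun x : ℤ => ∑ j, walkSymbol H.1 k c j *
        (Complex.exp (k * x * Complex.I) * amplitude H n x j e))
        ((walkSymbol H.1 k ^ (n + 1)) c e) := by
      rw [pow_succ', Matrix.mul_apply]
      exact hasSum_sum fun j _ => (ih j).mul_left _
    rw [← (Equiv.subRight (displacement c)).hasSum_iff] at hsum
    convert! hsum using 2 with x
    simp only [Function.comp_apply, Equiv.subRight_apply, amplitude_succ, Finset.mul_sum]
    refine Finset.sum_congr rfl fun j _ => ?_
    have hphase : Complex.exp (k * x * Complex.I) = Complex.exp (k * displacement c * Complex.I) *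
        Complex.exp (k * ((x - displacement c : ℤ) : ℂ) * Complex.I) := by
      rw [← Complex.exp_add]; congr 1; push_cast; ring
    rw [hphase, walkSymbol, diagonal_mul]
    ring

theorem walkSymbol_pow_apply (n : ℕ) (c e : Fin 2) (k : ℝ) :
    (walkSymbol H.1 k ^ n) c e = ∑ x ∈ Finset.Icc (-n : ℤ) n,
      Complex.exp (k * x * Complex.I) * amplitude H n x c e := by
  refine (hasSum_amplitude H n c e k).unique (hasSum_sum_of_ne_finset_zero fun x hx => ?_)
  rw [Finset.mem_Icc, ← abs_le, not_le] at hx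
  rw [amplitude_eq_zero H hx, mul_zero]

theorem walkSymbol_mem_unitaryGroup (k : ℝ) : walkSymbol H.1 k ∈ unitaryGroup (Fin 2) ℂ := by
  refine mul_mem ?_ H.2
  rw [mem_unitaryGroup_iff', star_eq_conjTranspose, diagonal_conjTranspose, diagonal_mul_diagonal,
    ← diagonal_one]
  congr 1
  funext c
  rw [Pi.star_apply, RCLike.star_def, Complex.conj_mul', ← Complex.ofReal_intCast,
    ← Complex.ofReal_mul, Complex.norm_exp_ofReal_mul_I]
  simp

/-- The overlap `½ Tr ((Û(k)ⁿ)† Û(k + ξ)ⁿ)` of the evolutions of two Fourier modes, whose average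
over `k` is the characteristic function of the position of the walk after `n` steps. -/
noncomputable def walkOverlap (n : ℕ) (ξ k : ℝ) : ℂ :=
  (1 / 2) * trace ((walkSymbol H.1 k ^ n)ᴴ * walkSymbol H.1 (k + ξ) ^ n)

theorem continuous_walkOverlap (n : ℕ) (ξ : ℝ) : Continuous (walkOverlap H n ξ) := by
  have := continuous_walkSymbol H.1
  unfold walkOverlap
  fun_prop

theorem walkOverlap_eq_sum (n : ℕ) (ξ k : ℝ) :
    walkOverlap H n ξ k = (1 / 2) * ∑ c, ∑ e,
      conj ((walkSymbol H.1 k ^ n) c e) * (walkSymbol H.1 (k + ξ) ^ n) c e := by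
  rw [walkOverlap, Finset.sum_comm]
  simp only [trace, diag_apply, mul_apply, conjTranspose_apply, RCLike.star_def]

theorem integral_walkOverlap (n : ℕ) (ξ : ℝ) :
    ∫ k in (0 : ℝ)..2 * Real.pi, walkOverlap H n ξ k =
      2 * Real.pi * ∑ x ∈ Finset.Icc (-n : ℤ) n,
        (walkProb H n x : ℂ) * Complex.exp (ξ * x * Complex.I) := by
  have hentry : ∀ c e, ∫ k in (0 : ℝ)..2 * Real.pi,
        conj ((walkSymbol H.1 k ^ n) c e) * (walkSymbol H.1 (k + ξ) ^ n) c e =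
      2 * Real.pi * ∑ x ∈ Finset.Icc (-n : ℤ) n,
        (‖amplitude H n x c e‖ ^ 2 : ℂ) * Complex.exp (ξ * x * Complex.I) := by
    intro c e
    have hshift : ∀ k : ℝ, (walkSymbol H.1 (k + ξ) ^ n) c e = ∑ x ∈ Finset.Icc (-n : ℤ) n,
        Complex.exp (k * x * Complex.I) *
          (Complex.exp (ξ * x * Complex.I) * amplitude H n x c e) := by
      intro k
      simp only [walkSymbol_pow_apply, Complex.ofReal_add, add_mul, Complex.exp_add, mul_assoc]
    simp only [hshift, walkSymbol_pow_apply, integral_conj_trigSum_mul_trigSum,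
      ← Complex.conj_mul']
    congr! 2
    ring
  have hcont : ∀ c e, Continuous fun k : ℝ =>
      conj ((walkSymbol H.1 k ^ n) c e) * (walkSymbol H.1 (k + ξ) ^ n) c e := by
    intro c e
    simp only [walkSymbol_pow_apply]
    fun_prop
  simp only [walkOverlap_eq_sum]
  rw [intervalIntegral.integral_const_mul, intervalIntegral.integral_finsetSum fun c _ =>
    (continuous_finsetSum _ fun e _ => hcont c e).intervalIntegrable _ _]
  simp only [intervalIntegral.integral_finsetSum fun e _ => (hcont _ e).intervalIntegrable _ _,
    hentry, ← Finset.mul_sum, walkProb_eq_sum_amplitude]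
  rw [mul_left_comm]
  simp only [Fin.sum_univ_two, ← Finset.sum_add_distrib, ← add_mul]
  rw [Finset.mul_sum]
  congr! 2
  push_cast
  ring

end Fourier

section WalkLaw

open Matrix

theorem norm_trace_le_card_of_mem_unitaryGroup {m : Type*} [Fintype m] [DecidableEq m]
    {U : Matrix m m ℂ} (hU : U ∈ unitaryGroup m ℂ) : ‖trace U‖ ≤ Fintype.card m := by
  refine (norm_sum_le_of_le _ fun i _ => entry_norm_bound_of_unitary hU i i).trans_eq ?_
  simp

variable (H : unitaryGroup (Fin 2) ℂ)

theorem norm_walkOverlap_le_one (n : ℕ) (ξ k : ℝ) : ‖walkOverlap H n ξ k‖ ≤ 1 := by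
  have hU := norm_trace_le_card_of_mem_unitaryGroup <| mul_mem
    (Unitary.star_mem (pow_mem (walkSymbol_mem_unitaryGroup H k) n))
    (pow_mem (walkSymbol_mem_unitaryGroup H (k + ξ)) n)
  rw [star_eq_conjTranspose, Fintype.card_fin, Nat.cast_ofNat] at hU
  have hhalf : ‖(1 / 2 : ℂ)‖ = 1 / 2 := by norm_num
  rw [walkOverlap, norm_mul, hhalf]
  linarith

theorem walkOverlap_zero_right (n : ℕ) (k : ℝ) : walkOverlap H n 0 k = 1 := by
  have hU := pow_mem (walkSymbol_mem_unitaryGroup H k) n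
  rw [mem_unitaryGroup_iff', star_eq_conjTranspose] at hU
  rw [walkOverlap, add_zero, hU, trace_one]
  simp

/-- The law of the position of the walk after `n` steps, as a measure on the real line. -/
noncomputable def walkLaw (n : ℕ) : Measure ℝ :=
  .sum fun x : ℤ => ENNReal.ofReal (walkProb H n x) • .dirac (x : ℝ)

theorem hasLaw_walkLaw {Ω : Type*} [MeasurableSpace Ω] {P : Measure Ω} [IsFiniteMeasure P]
    {Y : Ω → ℤ} (hY : Measurable Y) {n : ℕ}
    (hlaw : ∀ x, P.real {ω | Y ω = x} = walkProb H n x) :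
    HasLaw (fun ω => (Y ω : ℝ)) (walkLaw H n) P := by
  refine ⟨by fun_prop, ?_⟩
  change P.map ((fun x : ℤ => (x : ℝ)) ∘ Y) = _
  rw [← Measure.map_map (by fun_prop) hY, Measure.map_eq_sum P Y hY,
    Measure.map_sum (by fun_prop), walkLaw]
  congr 1
  funext x
  rw [Measure.map_smul, Measure.map_dirac, ← hlaw, ofReal_measureReal]
  rfl

theorem ae_walkLaw {n : ℕ} {p : ℝ → Prop} (hp : ∀ x : ℤ, walkProb H n x ≠ 0 → p x) :
    ∀ᵐ x ∂walkLaw H n, p x := by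
  rw [walkLaw, Measure.ae_sum_iff]
  intro x
  by_cases hx : walkProb H n x = 0
  · simp [hx]
  · refine Measure.ae_smul_measure ?_ _
    rw [ae_dirac_eq]
    exact hp x hx

theorem ae_abs_le_walkLaw (n : ℕ) : ∀ᵐ x ∂walkLaw H n, |x| ≤ (n : ℝ) :=
  ae_walkLaw H fun x hx => by
    by_contra! h
    exact hx (walkProb_eq_zero H (by exact_mod_cast h))

theorem walkLaw_eq_sum (n : ℕ) : walkLaw H n =
    ∑ x ∈ Finset.Icc (-n : ℤ) n, ENNReal.ofReal (walkProb H n x) • .dirac (x : ℝ) := by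
  ext s hs
  rw [walkLaw, Measure.sum_apply _ hs, tsum_eq_sum, Measure.finsetSum_apply]
  intro x hx
  rw [Finset.mem_Icc, ← abs_le, not_le] at hx
  simp [walkProb_eq_zero H hx]

theorem charFun_walkLaw (n : ℕ) (ξ : ℝ) : charFun (walkLaw H n) ξ =
    (2 * Real.pi : ℂ)⁻¹ * ∫ k in (0 : ℝ)..2 * Real.pi, walkOverlap H n ξ k := by
  have hpi : (2 * Real.pi : ℂ) ≠ 0 := by simp [Real.pi_ne_zero]
  rw [charFun_apply_real, walkLaw_eq_sum, integral_finsetSum_measure, integral_walkOverlap,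
    inv_mul_cancel_left₀ hpi]
  · simp [integral_smul_measure, ENNReal.toReal_ofReal (walkProb_nonneg H _ _)]
  · exact fun x _ => (integrable_cexp_mul_I ξ).smul_measure ENNReal.ofReal_ne_top

instance isProbabilityMeasure_walkLaw (n : ℕ) : IsProbabilityMeasure (walkLaw H n) := by
  have hpi : (2 * Real.pi : ℂ) ≠ 0 := by simp [Real.pi_ne_zero]
  rw [isProbabilityMeasure_iff_real, ← Complex.ofReal_inj, ← charFun_zero, charFun_walkLaw]
  simp only [walkOverlap_zero_right, intervalIntegral.integral_const, sub_zero]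
  simpa using inv_mul_cancel₀ hpi

theorem walkProb_one_eq_zero {x : ℤ} (hx : |x| ≠ 1) : walkProb H 1 x = 0 := by
  have hne : ∀ c, x - displacement c ≠ 0 := fun c h =>
    hx (by rw [sub_eq_zero.1 h, abs_displacement])
  simp [walkProb_eq_sum_amplitude, amplitude_succ, amplitude_zero, hne]

theorem integral_sq_walkLaw_one : ∫ x, x ^ 2 ∂walkLaw H 1 = 1 := by
  have hsq : ∀ᵐ x ∂walkLaw H 1, x ^ 2 = 1 := ae_walkLaw H fun x hx => by
    have h : |x| = 1 := by
      by_contra h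
      exact hx (walkProb_one_eq_zero H h)
    rw [← sq_abs]
    exact_mod_cast (by rw [h, one_pow] : |x| ^ 2 = 1)
  rw [integral_congr_ae hsq]
  simp

end WalkLaw

section SpecialUnitary

open Matrix

theorem cos_add_sin_smul_pow {A : Type*} [Ring A] [Algebra ℝ A] {J : A} (hJ : J * J = -1) (θ : ℝ)
    (n : ℕ) : (Real.cos θ • 1 + Real.sin θ • J) ^ n =
      Real.cos (n * θ) • (1 : A) + Real.sin (n * θ) • J := by
  have hlift : ∀ t : ℝ, Complex.lift ⟨J, hJ⟩ (Complex.cos t + Complex.sin t * Complex.I) =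
      Real.cos t • (1 : A) + Real.sin t • J := by
    intro t
    rw [Complex.lift_apply, Complex.liftAux_apply, Algebra.algebraMap_eq_smul_one]
    simp [Complex.cos_ofReal_re, Complex.sin_ofReal_re]
  rw [← hlift, ← map_pow, Complex.cos_add_sin_mul_I_pow, ← hlift]
  push_cast
  rfl

theorem conjTranspose_eq_adjugate {m : Type*} [Fintype m] [DecidableEq m] {V : Matrix m m ℂ}
    (hV : V ∈ specialUnitaryGroup m ℂ) : Vᴴ = adjugate V := by
  obtain ⟨hU, hdet⟩ := mem_specialUnitaryGroup_iff.1 hV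
  rw [mem_unitaryGroup_iff', star_eq_conjTranspose] at hU
  rw [← one_mul (adjugate V), ← hU, Matrix.mul_assoc, mul_adjugate, hdet, one_smul, Matrix.mul_one]

theorem exists_smul_mem_specialUnitaryGroup {m : Type*} [Fintype m] [DecidableEq m] [Nonempty m]
    {U : Matrix m m ℂ} (hU : U ∈ unitaryGroup m ℂ) :
    ∃ w : ℂ, ‖w‖ = 1 ∧ w • U ∈ specialUnitaryGroup m ℂ := by
  have hdet : ‖U.det‖ = 1 := CStarRing.norm_of_mem_unitary (det_of_mem_unitary hU)
  obtain ⟨w, hw⟩ := IsAlgClosed.exists_pow_nat_eq U.det⁻¹ (Fintype.card_pos (α := m))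
  have hnorm : ‖w‖ = 1 := by
    rw [← pow_eq_one_iff_of_nonneg (norm_nonneg w) Fintype.card_ne_zero (n := Fintype.card m),
      ← norm_pow, hw, norm_inv, hdet, inv_one]
  refine ⟨w, hnorm, mem_specialUnitaryGroup_iff.2 ⟨?_, ?_⟩⟩
  · refine Unitary.smul_mem_of_mem (Unitary.mem_iff_star_mul_self.2 ?_) hU
    rw [RCLike.star_def, Complex.conj_mul', hnorm, Complex.ofReal_one, one_pow]
  · rw [det_smul, hw, inv_mul_cancel₀ (norm_ne_zero_iff.1 (hdet ▸ one_ne_zero))]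

variable {V : Matrix (Fin 2) (Fin 2) ℂ}

theorem add_conjTranspose_eq_trace_smul_one (hV : V ∈ specialUnitaryGroup (Fin 2) ℂ) :
    V + Vᴴ = trace V • 1 := by
  rw [conjTranspose_eq_adjugate hV, adjugate_fin_two, trace_fin_two]
  ext i j
  fin_cases i <;> fin_cases j <;> simp [add_comm]

theorem star_trace_of_mem_specialUnitaryGroup (hV : V ∈ specialUnitaryGroup (Fin 2) ℂ) :
    star (trace V) = trace V := by
  rw [← trace_conjTranspose, conjTranspose_eq_adjugate hV, adjugate_fin_two, trace_fin_two,
    trace_fin_two]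
  exact add_comm _ _

/-- The axis `J = (V - cos θ) / sin θ` of a matrix `V ∈ SU(2)` with eigenvalues `e^{±iθ}`, for which
`V = cos θ + sin θ J`. -/
noncomputable def rotationAxis (V : Matrix (Fin 2) (Fin 2) ℂ) (θ : ℝ) :
    Matrix (Fin 2) (Fin 2) ℂ :=
  (Real.sin θ)⁻¹ • (V - Real.cos θ • 1)

theorem trace_rotationAxis {θ : ℝ} (htr : trace V = 2 * Real.cos θ) :
    trace (rotationAxis V θ) = 0 := by
  rw [rotationAxis, trace_smul, trace_sub, htr, trace_smul, trace_one]
  simp [mul_comm]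

theorem conjTranspose_eq_two_mul_cos_smul_one_sub (hV : V ∈ specialUnitaryGroup (Fin 2) ℂ) {θ : ℝ}
    (htr : trace V = 2 * Real.cos θ) : Vᴴ = (2 * Real.cos θ) • 1 - V := by
  rw [eq_sub_iff_add_eq', add_conjTranspose_eq_trace_smul_one hV, htr, ← Complex.coe_smul]
  push_cast
  rfl

theorem conjTranspose_rotationAxis (hV : V ∈ specialUnitaryGroup (Fin 2) ℂ) {θ : ℝ}
    (htr : trace V = 2 * Real.cos θ) : (rotationAxis V θ)ᴴ = -rotationAxis V θ := by
  rw [rotationAxis, conjTranspose_smul, conjTranspose_sub, conjTranspose_smul, conjTranspose_one,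
    conjTranspose_eq_two_mul_cos_smul_one_sub hV htr, star_trivial, star_trivial]
  module

theorem rotationAxis_mul_self (hV : V ∈ specialUnitaryGroup (Fin 2) ℂ) {θ : ℝ}
    (htr : trace V = 2 * Real.cos θ) (hθ : Real.sin θ ≠ 0) :
    rotationAxis V θ * rotationAxis V θ = -1 := by
  have hsq : V * V = (2 * Real.cos θ) • V - 1 := by
    have h := mem_unitaryGroup_iff.1 (mem_specialUnitaryGroup_iff.1 hV).1
    rw [star_eq_conjTranspose, conjTranspose_eq_two_mul_cos_smul_one_sub hV htr, mul_sub,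
      mul_smul_comm, mul_one] at h
    rw [← h, sub_sub_cancel]
  have hsub : (V - Real.cos θ • 1) * (V - Real.cos θ • 1) = -(Real.sin θ ^ 2 • 1) := by
    rw [Real.sin_sq]
    simp only [mul_sub, sub_mul, hsq, mul_smul_comm, smul_mul_assoc, mul_one, one_mul]
    module
  rw [rotationAxis, smul_mul_smul_comm, hsub, ← smul_neg, smul_smul]
  field_simp
  module

theorem pow_eq_cos_add_sin_smul_rotationAxis (hV : V ∈ specialUnitaryGroup (Fin 2) ℂ) {θ : ℝ}
    (htr : trace V = 2 * Real.cos θ) (hθ : Real.sin θ ≠ 0) (n : ℕ) :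
    V ^ n = Real.cos (n * θ) • 1 + Real.sin (n * θ) • rotationAxis V θ := by
  rw [← cos_add_sin_smul_pow (rotationAxis_mul_self hV htr hθ), rotationAxis, smul_inv_smul₀ hθ,
    add_sub_cancel]

theorem half_trace_conjTranspose_pow_mul_pow {V' : Matrix (Fin 2) (Fin 2) ℂ}
    (hV : V ∈ specialUnitaryGroup (Fin 2) ℂ) (hV' : V' ∈ specialUnitaryGroup (Fin 2) ℂ)
    {θ θ' : ℝ} (htr : trace V = 2 * Real.cos θ) (htr' : trace V' = 2 * Real.cos θ')
    (hθ : Real.sin θ ≠ 0) (hθ' : Real.sin θ' ≠ 0) (n : ℕ) :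
    (1 / 2) * trace ((V ^ n)ᴴ * V' ^ n) = Real.cos (n * (θ' - θ)) +
      Real.sin (n * θ) * Real.sin (n * θ') *
        ((1 / 2) * trace ((rotationAxis V θ)ᴴ * rotationAxis V' θ') - 1) := by
  rw [pow_eq_cos_add_sin_smul_rotationAxis hV htr hθ,
    pow_eq_cos_add_sin_smul_rotationAxis hV' htr' hθ']
  simp only [conjTranspose_add, conjTranspose_smul, conjTranspose_one, add_mul, mul_add, trace_add,
    smul_mul_assoc, mul_smul_comm, trace_smul, one_mul, mul_one, trace_one,
    trace_rotationAxis htr', trace_conjTranspose, trace_rotationAxis htr, mul_sub, Real.cos_sub,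
    Fintype.card_fin, Nat.cast_ofNat, star_trivial, star_zero, smul_zero, Complex.real_smul]
  push_cast
  ring

theorem half_trace_conjTranspose_rotationAxis_mul_self (hV : V ∈ specialUnitaryGroup (Fin 2) ℂ)
    {θ : ℝ} (htr : trace V = 2 * Real.cos θ) (hθ : Real.sin θ ≠ 0) :
    (1 / 2) * trace ((rotationAxis V θ)ᴴ * rotationAxis V θ) = 1 := by
  rw [conjTranspose_rotationAxis hV htr, neg_mul, rotationAxis_mul_self hV htr hθ, neg_neg,
    trace_one]
  simp

theorem continuousAt_rotationAxis {X : Type*} [TopologicalSpace X]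
    {V : X → Matrix (Fin 2) (Fin 2) ℂ} {ω : X → ℝ} {x : X} (hV : ContinuousAt V x)
    (hω : ContinuousAt ω x) (hsin : Real.sin (ω x) ≠ 0) :
    ContinuousAt (fun y => rotationAxis (V y) (ω y)) x := by
  unfold rotationAxis
  fun_prop (disch := exact hsin)

theorem tendsto_half_trace_pow {V : ℝ → Matrix (Fin 2) (Fin 2) ℂ} {ω : ℝ → ℝ}
    {k v : ℝ} (hV : ∀ k, V k ∈ specialUnitaryGroup (Fin 2) ℂ)
    (htr : ∀ k, trace (V k) = 2 * Real.cos (ω k)) (hcont : ContinuousAt V k)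
    (hω : HasDerivAt ω v k) (hsin : Real.sin (ω k) ≠ 0) (s : ℝ) :
    Tendsto (fun n : ℕ => (1 / 2) * trace ((V k ^ n)ᴴ * V (k + s / n) ^ n)) atTop
      (𝓝 (Real.cos (s * v))) := by
  have hn := tendsto_natCast_atTop_atTop (R := ℝ)
  have hk : Tendsto (fun n : ℕ => k + s / n) atTop (𝓝 k) := by
    simpa using (tendsto_const_nhds.div_atTop hn (a := s)).const_add k
  have hphase : Tendsto (fun n : ℕ => (n : ℝ) * (ω (k + s / n) - ω k)) atTop (𝓝 (s * v)) := by
    simpa [Function.comp_def, div_eq_inv_mul] using (hω.hasFDerivAt.lim_real s).comp hn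
  have hsin' : ∀ᶠ n : ℕ in atTop, Real.sin (ω (k + s / n)) ≠ 0 :=
    hk.eventually ((Real.continuous_sin.continuousAt.comp hω.continuousAt).eventually_ne hsin)
  set J : ℝ → Matrix (Fin 2) (Fin 2) ℂ := fun k' => rotationAxis (V k') (ω k')
  have haxis : Tendsto (fun n : ℕ => (1 / 2) * trace ((J k)ᴴ * J (k + s / n)) - 1) atTop (𝓝 0) := by
    have hJcont : ContinuousAt J k := continuousAt_rotationAxis hcont hω.continuousAt hsin
    have hc : ContinuousAt (fun k' => (1 / 2) * trace ((J k)ᴴ * J k') - 1) k := by fun_prop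
    have h := hc.tendsto.comp hk
    rwa [half_trace_conjTranspose_rotationAxis_mul_self (hV k) (htr k) hsin, sub_self] at h
  have hrem : Tendsto (fun n : ℕ => (Real.sin (n * ω k) * Real.sin (n * ω (k + s / n)) : ℂ) *
      ((1 / 2) * trace ((J k)ᴴ * J (k + s / n)) - 1)) atTop (𝓝 0) := by
    refine squeeze_zero_norm (fun n => ?_) (tendsto_zero_iff_norm_tendsto_zero.1 haxis)
    rw [norm_mul, norm_mul, Complex.norm_real, Complex.norm_real]
    exact mul_le_of_le_one_left (norm_nonneg _)
      (mul_le_one₀ (Real.abs_sin_le_one _) (norm_nonneg _) (Real.abs_sin_le_one _))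
  have hmain := ((Complex.continuous_ofReal.comp Real.continuous_cos).tendsto _).comp hphase
  rw [← add_zero (Complex.ofReal _)]
  refine (hmain.add hrem).congr' ?_
  filter_upwards [hsin'] with n hsin'
  exact (half_trace_conjTranspose_pow_mul_pow (hV k) (hV _) (htr k) (htr _) hsin hsin' _).symm

end SpecialUnitary

section QuasiEnergy

/-- The quasi-energy of the walk: up to a global phase and a shift of `k`, the eigenvalues of the
walk operator in Fourier space are `e^{±iω(k)}` with `cos ω(k) = r cos k`, where `r = |a|`. -/
noncomputable def quasiEnergy (r k : ℝ) : ℝ := Real.arccos (r * Real.cos k)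

/-- The group velocity `ω'(k)` of the quasi-energy `ω`. -/
noncomputable def groupVelocity (r k : ℝ) : ℝ :=
  r * Real.sin k / √(1 - r ^ 2 * Real.cos k ^ 2)

theorem groupVelocity_neg (r k : ℝ) : groupVelocity r (-k) = -groupVelocity r k := by
  simp [groupVelocity, neg_div]

theorem groupVelocity_add_pi (r k : ℝ) : groupVelocity r (k + Real.pi) = -groupVelocity r k := by
  simp [groupVelocity, neg_div]

variable {r : ℝ}

theorem one_sub_sq_mul_cos_sq_pos (hr : r ^ 2 < 1) (k : ℝ) : 0 < 1 - r ^ 2 * Real.cos k ^ 2 := by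
  nlinarith [Real.cos_sq_le_one k, sq_nonneg r]

theorem abs_mul_cos_lt_one (hr : r ^ 2 < 1) (k : ℝ) : |r * Real.cos k| < 1 := by
  rw [← sq_lt_one_iff_abs_lt_one, mul_pow]
  linarith [one_sub_sq_mul_cos_sq_pos hr k]

theorem cos_quasiEnergy (hr : r ^ 2 < 1) (k : ℝ) :
    Real.cos (quasiEnergy r k) = r * Real.cos k :=
  have h := abs_lt.1 (abs_mul_cos_lt_one hr k)
  Real.cos_arccos h.1.le h.2.le

theorem sin_quasiEnergy_pos (hr : r ^ 2 < 1) (k : ℝ) : 0 < Real.sin (quasiEnergy r k) := by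
  rw [quasiEnergy, Real.sin_arccos, mul_pow]
  exact Real.sqrt_pos.2 (one_sub_sq_mul_cos_sq_pos hr k)

theorem hasDerivAt_quasiEnergy (hr : r ^ 2 < 1) (k : ℝ) :
    HasDerivAt (quasiEnergy r) (groupVelocity r k) k := by
  have h := abs_lt.1 (abs_mul_cos_lt_one hr k)
  convert! (Real.hasDerivAt_arccos h.1.ne' h.2.ne).comp k
    ((Real.hasDerivAt_cos k).const_mul r) using 1
  rw [groupVelocity, mul_pow]
  ring

theorem continuous_groupVelocity (hr : r ^ 2 < 1) : Continuous (groupVelocity r) :=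
  Continuous.div (by fun_prop) (by fun_prop) fun k =>
    (Real.sqrt_pos.2 (one_sub_sq_mul_cos_sq_pos hr k)).ne'

theorem groupVelocity_sq (hr : r ^ 2 < 1) (k : ℝ) :
    groupVelocity r k ^ 2 = 1 - (1 - r ^ 2) / (1 - r ^ 2 * Real.cos k ^ 2) := by
  have hD := one_sub_sq_mul_cos_sq_pos hr k
  rw [groupVelocity, div_pow, Real.sq_sqrt hD.le, mul_pow, Real.sin_sq]
  field_simp
  ring

theorem hasDerivAt_groupVelocity (hr : r ^ 2 < 1) (k : ℝ) :
    HasDerivAt (groupVelocity r) (r * Real.cos k * (1 - r ^ 2) /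
      ((1 - r ^ 2 * Real.cos k ^ 2) * √(1 - r ^ 2 * Real.cos k ^ 2))) k := by
  have hpos := one_sub_sq_mul_cos_sq_pos hr k
  have hsqrt := Real.sqrt_pos.2 hpos
  have hD : HasDerivAt (fun k => 1 - r ^ 2 * Real.cos k ^ 2)
      (2 * r ^ 2 * Real.cos k * Real.sin k) k := by
    convert! (((Real.hasDerivAt_cos k).pow 2).const_mul (r ^ 2)).const_sub 1 using 1
    push_cast
    ring
  convert! ((Real.hasDerivAt_sin k).const_mul r).div (hD.sqrt hpos.ne') hsqrt.ne' using 1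
  have hsq := Real.sq_sqrt hpos.le
  rw [hsq]
  field_simp
  rw [hsq]
  linear_combination (r ^ 3 * Real.cos k) * Real.sin_sq_add_cos_sq k

end QuasiEnergy

section KonnoLaw

variable {r : ℝ}

theorem deriv_groupVelocity_pos (h0 : 0 < r) (h1 : r < 1) {k : ℝ}
    (hk : k ∈ Set.Ioo (-(Real.pi / 2)) (Real.pi / 2)) :
    0 < r * Real.cos k * (1 - r ^ 2) /
      ((1 - r ^ 2 * Real.cos k ^ 2) * √(1 - r ^ 2 * Real.cos k ^ 2)) := by
  have hr : r ^ 2 < 1 := by nlinarith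
  have hcos := Real.cos_pos_of_mem_Ioo hk
  have hD := one_sub_sq_mul_cos_sq_pos hr k
  have := sub_pos.2 hr
  positivity

theorem strictMonoOn_groupVelocity (h0 : 0 < r) (h1 : r < 1) :
    StrictMonoOn (groupVelocity r) (Set.Icc (-(Real.pi / 2)) (Real.pi / 2)) := by
  have hr : r ^ 2 < 1 := by nlinarith
  refine strictMonoOn_of_deriv_pos (convex_Icc _ _)
    (continuous_groupVelocity hr).continuousOn fun k hk => ?_
  rw [interior_Icc] at hk
  rw [(hasDerivAt_groupVelocity hr k).deriv]
  exact deriv_groupVelocity_pos h0 h1 hk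

theorem image_groupVelocity_Ioo (h0 : 0 < r) (h1 : r < 1) :
    groupVelocity r '' Set.Ioo (-(Real.pi / 2)) (Real.pi / 2) = Set.Ioo (-r) r := by
  have hr : r ^ 2 < 1 := by nlinarith
  have hend : groupVelocity r (Real.pi / 2) = r := by simp [groupVelocity]
  refine Set.Subset.antisymm ?_ ?_
  · have h := (strictMonoOn_groupVelocity h0 h1).image_Ioo_subset
    rwa [groupVelocity_neg, hend] at h
  · have h := intermediate_value_Ioo (a := -(Real.pi / 2)) (b := Real.pi / 2)
      (by linarith [Real.pi_pos]) (continuous_groupVelocity hr).continuousOn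
    rwa [groupVelocity_neg, hend] at h

theorem deriv_groupVelocity_mul_konnoDensity (h0 : 0 < r) (h1 : r < 1) {k : ℝ}
    (hk : k ∈ Set.Ioo (-(Real.pi / 2)) (Real.pi / 2)) :
    r * Real.cos k * (1 - r ^ 2) / ((1 - r ^ 2 * Real.cos k ^ 2) * √(1 - r ^ 2 * Real.cos k ^ 2)) *
      konnoDensity r (groupVelocity r k) = Real.pi⁻¹ := by
  have hmem : groupVelocity r k ∈ Set.Ioo (-r) r :=
    image_groupVelocity_Ioo h0 h1 ▸ Set.mem_image_of_mem _ hk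
  have hr2 : r ^ 2 < 1 := by nlinarith
  have hcos := Real.cos_pos_of_mem_Ioo hk
  have hr := sub_pos.2 hr2
  have hD := one_sub_sq_mul_cos_sq_pos hr2 k
  have hsqrt : √(r ^ 2 - groupVelocity r k ^ 2) =
      r * Real.cos k * √(1 - r ^ 2) / √(1 - r ^ 2 * Real.cos k ^ 2) := by
    rw [Real.sqrt_eq_iff_mul_self_eq_of_pos (by positivity), groupVelocity_sq hr2,
      ← sq, div_pow, mul_pow, Real.sq_sqrt hr.le, Real.sq_sqrt hD.le]
    field_simp
    ring
  rw [konnoDensity, Set.indicator_of_mem hmem, hsqrt, groupVelocity_sq hr2, sub_sub_cancel]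
  have := Real.sqrt_pos.2 hr
  have := Real.sqrt_pos.2 hD
  field_simp

theorem measurable_konnoDensity (r : ℝ) : Measurable (konnoDensity r) :=
  Measurable.indicator (by fun_prop) measurableSet_Ioo

theorem konnoDensity_nonneg (h1 : r < 1) (x : ℝ) : 0 ≤ konnoDensity r x := by
  refine Set.indicator_nonneg (fun y hy => ?_) x
  have : y ^ 2 < 1 := by
    nlinarith [hy.1, hy.2]
  have := sub_pos.2 this
  positivity

/-- The law `K(r)` is that of the group velocity of a uniformly distributed wave number. -/
theorem integral_konnoLaw (h0 : 0 < r) (h1 : r < 1) {E : Type*} [NormedAddCommGroup E]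
    [NormedSpace ℝ E] (f : ℝ → E) : ∫ x, f x ∂konnoLaw r =
      Real.pi⁻¹ • ∫ k in -(Real.pi / 2)..Real.pi / 2, f (groupVelocity r k) := by
  have hr : r ^ 2 < 1 := by nlinarith
  rw [konnoLaw, integral_withDensity_eq_integral_toReal_smul
    (measurable_konnoDensity r).ennreal_ofReal (.of_forall fun _ => ENNReal.ofReal_lt_top)]
  simp only [ENNReal.toReal_ofReal (konnoDensity_nonneg h1 _)]
  rw [← setIntegral_eq_integral_of_forall_compl_eq_zero (s := Set.Ioo (-r) r) fun x hx => by
      rw [konnoDensity, Set.indicator_of_notMem hx, zero_smul], ← image_groupVelocity_Ioo h0 h1,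
    integral_image_eq_integral_abs_deriv_smul measurableSet_Ioo
      (fun k _ => (hasDerivAt_groupVelocity hr k).hasDerivWithinAt)
      ((strictMonoOn_groupVelocity h0 h1).mono Set.Ioo_subset_Icc_self).injOn,
    intervalIntegral.integral_of_le (by linarith [Real.pi_pos]), integral_Ioc_eq_integral_Ioo,
    ← integral_smul]
  refine setIntegral_congr_fun measurableSet_Ioo fun k hk => ?_
  rw [abs_of_pos (deriv_groupVelocity_pos h0 h1 hk), smul_smul,
    deriv_groupVelocity_mul_konnoDensity h0 h1 hk]

theorem isProbabilityMeasure_konnoLaw (h0 : 0 < r) (h1 : r < 1) :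
    IsProbabilityMeasure (konnoLaw r) := by
  have h := integral_konnoLaw h0 h1 fun _ => (1 : ℝ)
  rw [integral_const, intervalIntegral.integral_const] at h
  rw [isProbabilityMeasure_iff_real, ← mul_one (Measure.real _ _), ← smul_eq_mul, h]
  have := Real.pi_pos
  simp only [smul_eq_mul]
  field_simp
  ring

theorem ae_abs_le_konnoLaw (r : ℝ) : ∀ᵐ x ∂konnoLaw r, |x| ≤ r := by
  rw [konnoLaw, ae_withDensity_iff (measurable_konnoDensity r).ennreal_ofReal]
  refine .of_forall fun x hx => ?_
  by_contra h
  refine hx ?_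
  rw [konnoDensity, Set.indicator_of_notMem, ENNReal.ofReal_zero]
  exact fun hx => h (abs_le.2 ⟨hx.1.le, hx.2.le⟩)

theorem integral_cos_mul_groupVelocity (hr : r ^ 2 < 1) (s : ℝ) :
    ∫ k in (0 : ℝ)..2 * Real.pi, Real.cos (s * groupVelocity r k) =
      2 * ∫ k in -(Real.pi / 2)..Real.pi / 2, Real.cos (s * groupVelocity r k) := by
  have hper : Function.Periodic (fun k => Real.cos (s * groupVelocity r k)) Real.pi := fun k => by
    simp only [groupVelocity_add_pi, mul_neg, Real.cos_neg]
  have hcont := continuous_groupVelocity hr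
  have hsplit := hper.intervalIntegral_add_eq_add 0 Real.pi
    (fun a b => Continuous.intervalIntegrable (by fun_prop) a b)
  have hshift := hper.intervalIntegral_add_eq 0 (-(Real.pi / 2))
  have hend : -(Real.pi / 2) + Real.pi = Real.pi / 2 := by ring
  rw [zero_add, hend] at hshift
  rw [zero_add, ← two_mul, hshift, ← two_mul] at hsplit
  exact hsplit

theorem charFun_konnoLaw (h0 : 0 < r) (h1 : r < 1) (s : ℝ) : charFun (konnoLaw r) s =
    (2 * Real.pi : ℂ)⁻¹ *
      ∫ k in (0 : ℝ)..2 * Real.pi, (Real.cos (s * groupVelocity r k) : ℂ) := by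
  have hr : r ^ 2 < 1 := by nlinarith
  have hcont := continuous_groupVelocity hr
  have hsin : ∫ k in -(Real.pi / 2)..Real.pi / 2, Real.sin (s * groupVelocity r k) = 0 := by
    have h := intervalIntegral.integral_comp_neg (a := -(Real.pi / 2)) (b := Real.pi / 2)
      fun k => Real.sin (s * groupVelocity r k)
    simp only [groupVelocity_neg, mul_neg, Real.sin_neg, intervalIntegral.integral_neg,
      neg_neg] at h
    linarith
  simp only [charFun_apply_real, integral_konnoLaw h0 h1, ← Complex.ofReal_mul, Complex.exp_mul_I,
    ← Complex.ofReal_cos, ← Complex.ofReal_sin]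
  rw [intervalIntegral.integral_add (Continuous.intervalIntegrable (by fun_prop) _ _)
    (Continuous.intervalIntegrable (by fun_prop) _ _), intervalIntegral.integral_mul_const,
    intervalIntegral.integral_ofReal, intervalIntegral.integral_ofReal, hsin,
    intervalIntegral.integral_ofReal, integral_cos_mul_groupVelocity hr, Complex.real_smul]
  push_cast
  field_simp
  ring

theorem continuous_div_sq_mul_cos_sq_add_sin_sq {e : ℝ} (he : 0 < e) :
    Continuous fun k => e / (e ^ 2 * Real.cos k ^ 2 + Real.sin k ^ 2) := by
  refine Continuous.div (by fun_prop) (by fun_prop) fun k => ?_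
  rcases eq_or_ne (Real.cos k) 0 with hcos | hcos
  · norm_num [Real.sin_sq, hcos]
  · positivity

theorem integral_div_sq_mul_cos_sq_add_sin_sq {e : ℝ} (he : 0 < e) :
    ∫ k in -(Real.pi / 2)..Real.pi / 2, e / (e ^ 2 * Real.cos k ^ 2 + Real.sin k ^ 2) =
      Real.pi := by
  have hlt : -(Real.pi / 2) < Real.pi / 2 := by linarith [Real.pi_pos]
  have hderiv : ∀ k ∈ Set.Ioo (-(Real.pi / 2)) (Real.pi / 2),
      HasDerivAt (fun k => Real.arctan (Real.tan k / e))
        (e / (e ^ 2 * Real.cos k ^ 2 + Real.sin k ^ 2)) k := by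
    intro k hk
    have hcos := Real.cos_pos_of_mem_Ioo hk
    convert! ((Real.hasDerivAt_tan hcos.ne').div_const e).arctan using 1
    rw [Real.tan_eq_sin_div_cos]
    field_simp
  have hright : Tendsto (fun k => Real.arctan (Real.tan k / e)) (𝓝[<] (Real.pi / 2))
      (𝓝 (Real.pi / 2)) :=
    (Real.tendsto_arctan_atTop.comp (Real.tendsto_tan_pi_div_two.atTop_div_const he)).mono_right
      nhdsWithin_le_nhds
  have hleft : Tendsto (fun k => Real.arctan (Real.tan k / e)) (𝓝[>] (-(Real.pi / 2)))
      (𝓝 (-(Real.pi / 2))) :=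
    (Real.tendsto_arctan_atBot.comp (Real.tendsto_tan_neg_pi_div_two.atBot_div_const he)).mono_right
      nhdsWithin_le_nhds
  rw [intervalIntegral.integral_eq_sub_of_hasDerivAt_of_tendsto hlt hderiv
    ((continuous_div_sq_mul_cos_sq_add_sin_sq he).intervalIntegrable _ _) hleft hright]
  ring

theorem integral_sq_konnoLaw (h0 : 0 < r) (h1 : r < 1) :
    ∫ x, x ^ 2 ∂konnoLaw r = 1 - √(1 - r ^ 2) := by
  have hr : r ^ 2 < 1 := by nlinarith
  have he := Real.sqrt_pos.2 (sub_pos.2 hr)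
  have he2 := Real.sq_sqrt (sub_pos.2 hr).le
  set e := √(1 - r ^ 2)
  have hsq : ∀ k, groupVelocity r k ^ 2 =
      1 - e * (e / (e ^ 2 * Real.cos k ^ 2 + Real.sin k ^ 2)) := by
    intro k
    rw [groupVelocity_sq hr, mul_div_assoc', ← sq, he2, Real.sin_sq]
    ring_nf
  rw [integral_konnoLaw h0 h1]
  simp only [hsq]
  rw [intervalIntegral.integral_sub intervalIntegrable_const
      (((continuous_div_sq_mul_cos_sq_add_sin_sq he).intervalIntegrable _ _).const_mul _),
    intervalIntegral.integral_const_mul, integral_div_sq_mul_cos_sq_add_sin_sq he,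
    intervalIntegral.integral_const]
  simp only [smul_eq_mul]
  field_simp
  ring

end KonnoLaw

section WalkLimit

open ComplexConjugate Matrix

section SpecialUnitarySymbol

variable {W : Matrix (Fin 2) (Fin 2) ℂ}

theorem walkSymbol_mem_specialUnitaryGroup (hW : W ∈ specialUnitaryGroup (Fin 2) ℂ) (k : ℝ) :
    walkSymbol W k ∈ specialUnitaryGroup (Fin 2) ℂ := by
  obtain ⟨hU, hdet⟩ := mem_specialUnitaryGroup_iff.1 hW
  refine mem_specialUnitaryGroup_iff.2 ⟨walkSymbol_mem_unitaryGroup ⟨W, hU⟩ k, ?_⟩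
  rw [walkSymbol, det_mul, hdet, det_diagonal, Fin.prod_univ_two, ← Complex.exp_add]
  simp [displacement]

theorem trace_walkSymbol (hW : W ∈ specialUnitaryGroup (Fin 2) ℂ) (k : ℝ) :
    trace (walkSymbol W k) = 2 * (‖W 0 0‖ * Real.cos (k - (W 0 0).arg) : ℝ) := by
  have hentry : W 1 1 = conj (W 0 0) := by
    have h := congr_fun₂ (conjTranspose_eq_adjugate hW) 0 0
    rw [adjugate_fin_two] at h
    simpa using h.symm
  have hpolar : Complex.exp (-(k * Complex.I)) * W 0 0 =
      ‖W 0 0‖ * Complex.exp (((-(k - (W 0 0).arg) : ℝ) : ℂ) * Complex.I) := by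
    conv_lhs => rw [← Complex.norm_mul_exp_arg_mul_I (W 0 0)]
    rw [mul_left_comm, ← Complex.exp_add]
    push_cast
    ring_nf
  have htrace : trace (walkSymbol W k) = Complex.exp (-(k * Complex.I)) * W 0 0 +
      conj (Complex.exp (-(k * Complex.I)) * W 0 0) := by
    rw [walkSymbol, trace_fin_two, diagonal_mul, diagonal_mul, hentry, map_mul,
      ← Complex.exp_conj]
    simp [displacement]
  rw [htrace, Complex.add_conj, hpolar, Complex.re_ofReal_mul, Complex.exp_ofReal_mul_I_re,
    Real.cos_neg]
  push_cast
  rfl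

end SpecialUnitarySymbol

variable (H : unitaryGroup (Fin 2) ℂ)

theorem exists_specialUnitaryGroup_walkOverlap_eq :
    ∃ W ∈ specialUnitaryGroup (Fin 2) ℂ, ‖W 0 0‖ = ‖H.1 0 0‖ ∧ ∀ n ξ k,
      walkOverlap H n ξ k = (1 / 2) * trace ((walkSymbol W k ^ n)ᴴ * walkSymbol W (k + ξ) ^ n) := by
  obtain ⟨w, hw, hW⟩ := exists_smul_mem_specialUnitaryGroup H.2
  refine ⟨w • H.1, hW, by rw [Matrix.smul_apply, norm_smul, hw, one_mul], fun n ξ k => ?_⟩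
  have hphase : star (w ^ n) * w ^ n = 1 := by
    rw [RCLike.star_def, Complex.conj_mul', norm_pow, hw, one_pow, Complex.ofReal_one, one_pow]
  have hsmul : ∀ k, walkSymbol (w • H.1) k = w • walkSymbol H.1 k := fun k => mul_smul_comm _ _ _
  rw [hsmul, hsmul, smul_pow, smul_pow, conjTranspose_smul, smul_mul_smul_comm, hphase, one_smul,
    walkOverlap]

theorem conj_walkOverlap (n : ℕ) (ξ k : ℝ) :
    conj (walkOverlap H n ξ k) = walkOverlap H n ξ k := by
  obtain ⟨W, hW, -, hoverlap⟩ := exists_specialUnitaryGroup_walkOverlap_eq H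
  have hS := walkSymbol_mem_specialUnitaryGroup hW
  have h := star_trace_of_mem_specialUnitaryGroup <|
    mul_mem (star (⟨_, pow_mem (hS k) n⟩ : specialUnitaryGroup (Fin 2) ℂ)).2
      (pow_mem (hS (k + ξ)) n)
  rw [specialUnitaryGroup.coe_star, star_eq_conjTranspose, RCLike.star_def] at h
  rw [hoverlap, map_mul, h]
  simp [Complex.conj_ofNat]

theorem integral_id_walkLaw (n : ℕ) : ∫ x, x ∂walkLaw H n = 0 :=
  integral_id_eq_zero_of_conj_charFun fun ξ => by
    rw [charFun_walkLaw, map_mul, intervalIntegral.integral_of_le (by positivity), ← integral_conj]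
    simp [conj_walkOverlap, Complex.conj_ofNat]

theorem tendsto_walkOverlap (h1 : ‖H.1 0 0‖ < 1) :
    ∃ α, ∀ s k, Tendsto (fun n : ℕ => walkOverlap H n (s / n) k) atTop
      (𝓝 (Real.cos (s * groupVelocity ‖H.1 0 0‖ (k - α)))) := by
  obtain ⟨W, hW, hnorm, hoverlap⟩ := exists_specialUnitaryGroup_walkOverlap_eq H
  have hr : ‖H.1 0 0‖ ^ 2 < 1 := by nlinarith [norm_nonneg (H.1 0 0)]
  refine ⟨(W 0 0).arg, fun s k => ?_⟩
  simp only [hoverlap]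
  refine tendsto_half_trace_pow (walkSymbol_mem_specialUnitaryGroup hW) (fun k => ?_)
    (continuous_walkSymbol W).continuousAt ((hasDerivAt_quasiEnergy hr _).comp_sub_const k _)
    (sin_quasiEnergy_pos hr _).ne' s
  rw [trace_walkSymbol hW, hnorm, cos_quasiEnergy hr]

theorem tendsto_charFun_walkLaw (h0 : 0 < ‖H.1 0 0‖) (h1 : ‖H.1 0 0‖ < 1) (s : ℝ) :
    Tendsto (fun n : ℕ => charFun (walkLaw H n) (s / n)) atTop
      (𝓝 (charFun (konnoLaw ‖H.1 0 0‖) s)) := by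
  obtain ⟨α, hα⟩ := tendsto_walkOverlap H h1
  have hper : Function.Periodic
      (fun k => (Real.cos (s * groupVelocity ‖H.1 0 0‖ k) : ℂ)) (2 * Real.pi) := fun k => by
    simp only [two_mul, ← add_assoc, groupVelocity_add_pi, neg_neg]
  have hshift : ∫ k in (0 : ℝ)..2 * Real.pi, (Real.cos (s * groupVelocity ‖H.1 0 0‖ (k - α)) : ℂ) =
      ∫ k in (0 : ℝ)..2 * Real.pi, (Real.cos (s * groupVelocity ‖H.1 0 0‖ k) : ℂ) := by
    rw [intervalIntegral.integral_comp_sub_right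
      (fun k => (Real.cos (s * groupVelocity ‖H.1 0 0‖ k) : ℂ)), sub_eq_neg_add,
      sub_eq_neg_add, add_zero, hper.intervalIntegral_add_eq _ 0, zero_add]
  simp only [charFun_walkLaw, charFun_konnoLaw h0 h1, ← hshift]
  refine (intervalIntegral.tendsto_integral_filter_of_dominated_convergence (fun _ => 1)
    (.of_forall fun n => (continuous_walkOverlap H n _).aestronglyMeasurable)
    (.of_forall fun n => .of_forall fun k _ => norm_walkOverlap_le_one H n _ k)
    intervalIntegrable_const (.of_forall fun k _ => hα s k)).const_mul _

theorem tendsto_integral_sq_walkLaw (h0 : 0 < ‖H.1 0 0‖) (h1 : ‖H.1 0 0‖ < 1) :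
    Tendsto (fun n : ℕ => (∫ x, x ^ 2 ∂walkLaw H n) / (n : ℝ) ^ 2) atTop
      (𝓝 (1 - √(1 - ‖H.1 0 0‖ ^ 2))) := by
  have := isProbabilityMeasure_konnoLaw h0 h1
  let μ : ℕ → ProbabilityMeasure ℝ := fun n =>
    ⟨(walkLaw H n).map ((n : ℝ)⁻¹ * ·), Measure.isProbabilityMeasure_map (by fun_prop)⟩
  have hlim : Tendsto μ atTop (𝓝 ⟨konnoLaw ‖H.1 0 0‖, this⟩) := by
    refine ProbabilityMeasure.tendsto_iff_tendsto_charFun.2 fun s => ?_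
    refine (tendsto_charFun_walkLaw H h0 h1 s).congr fun n => ?_
    rw [div_eq_inv_mul, ← charFun_map_mul]
    rfl
  have hμ : ∀ n, ∀ᵐ x ∂(μ n : Measure ℝ), x ∈ Set.Icc (-1) 1 := fun n => by
    refine (ae_map_iff (by fun_prop) measurableSet_Icc).2 ?_
    filter_upwards [ae_abs_le_walkLaw H n] with x hx
    refine abs_le.1 ?_
    rw [abs_mul, abs_inv, Nat.abs_cast, ← div_eq_inv_mul]
    exact div_le_one_of_le₀ hx n.cast_nonneg
  have hν : ∀ᵐ x ∂konnoLaw ‖H.1 0 0‖, x ∈ Set.Icc (-1) 1 :=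
    (ae_abs_le_konnoLaw _).mono fun x hx => abs_le.1 (hx.trans h1.le)
  have h := tendsto_integral_of_ae_mem_isCompact hlim isCompact_Icc hμ hν
    (continuous_pow 2).continuousOn
  rw [ProbabilityMeasure.coe_mk, integral_sq_konnoLaw h0 h1] at h
  refine h.congr fun n => ?_
  rw [ProbabilityMeasure.coe_mk, integral_map (by fun_prop) (by fun_prop)]
  simp only [mul_pow, integral_const_mul]
  rw [inv_pow, div_eq_inv_mul]

end WalkLimit

section MeasuredWalk

open Matrix

theorem sum_norm_sq_row_of_mem_unitaryGroup {m : Type*} [Fintype m] [DecidableEq m]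
    {U : Matrix m m ℂ} (hU : U ∈ unitaryGroup m ℂ) (i : m) : ∑ j, ‖U i j‖ ^ 2 = 1 := by
  have h := congr_fun₂ (mem_unitaryGroup_iff.1 hU) i i
  simp only [mul_apply, star_apply, RCLike.star_def, Complex.mul_conj', one_apply_eq] at h
  exact_mod_cast h

theorem norm_lt_one_of_mem_unitaryGroup {m : Type*} [Fintype m] [DecidableEq m]
    {U : Matrix m m ℂ} (hU : U ∈ unitaryGroup m ℂ) {i j j' : m} (hj : j ≠ j') (h : U i j' ≠ 0) :
    ‖U i j‖ < 1 := by
  have hpos : 0 < ‖U i j'‖ ^ 2 := by positivity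
  have hle := Finset.add_le_sum (f := fun j => ‖U i j‖ ^ 2) (fun _ _ => sq_nonneg _)
    (Finset.mem_univ j) (Finset.mem_univ j') hj
  rw [sum_norm_sq_row_of_mem_unitaryGroup hU] at hle
  rw [← sq_lt_one_iff₀ (norm_nonneg _)]
  linarith

variable {α : Type*} {l : Filter α}

theorem eventually_eq_of_tendsto_natCast {f : α → ℕ} {m : ℕ}
    (h : Tendsto (fun n => (f n : ℝ)) l (𝓝 m)) : ∀ᶠ n in l, f n = m := by
  have := Nat.isClosedEmbedding_coe_real.isInducing.tendsto_nhds_iff.2 h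
  rwa [nhds_discrete, tendsto_pure] at this

theorem tendsto_div_rpow_of_isEquivalent_rpow {t d : α → ℝ} {β γ : ℝ} (ht : Tendsto t l atTop)
    (hd : d ~[l] fun n => t n ^ β) (hγ : β < γ) : Tendsto (fun n => d n / t n ^ γ) l (𝓝 0) := by
  have h := (hd.mul (.refl (u := fun n => (t n ^ γ)⁻¹))).symm.tendsto_nhds (c := 0) ?_
  · simpa only [Pi.mul_def, div_eq_mul_inv] using h
  refine ((tendsto_rpow_neg_atTop (sub_pos.2 hγ)).comp ht).congr' ?_
  filter_upwards [ht.eventually_gt_atTop 0] with n hn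
  simp only [Function.comp_apply, Pi.mul_apply, neg_sub, Real.rpow_sub hn, div_eq_mul_inv]

theorem tendsto_mul_div_rpow_sq {t d M σ : α → ℝ} {β v : ℝ} (htdM : ∀ n, t n = d n * M n)
    (ht : Tendsto t l atTop) (hd : d ~[l] fun n => t n ^ β)
    (hσ : Tendsto (fun n => σ n / d n ^ 2) l (𝓝 v)) :
    Tendsto (fun n => M n * σ n / (t n ^ ((1 + β) / 2)) ^ 2) l (𝓝 v) := by
  have hpos := ht.eventually_gt_atTop 0
  have hratio : Tendsto (fun n => d n / t n ^ β) l (𝓝 1) :=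
    (Asymptotics.isEquivalent_iff_tendsto_one
      (hpos.mono fun n hn => (Real.rpow_pos_of_pos hn β).ne')).1 hd
  have h := hσ.mul hratio
  rw [mul_one] at h
  refine h.congr' ?_
  filter_upwards [hpos] with n hn
  have hd0 : d n ≠ 0 := left_ne_zero_of_mul (htdM n ▸ hn.ne')
  have hβ := (Real.rpow_pos_of_pos hn β).ne'
  rw [← Real.rpow_mul_natCast hn.le, Nat.cast_ofNat, div_mul_cancel₀ _ two_ne_zero,
    Real.rpow_add hn, Real.rpow_one]
  have hM : M n = t n / d n := by rw [htdM n, mul_div_cancel_left₀ _ hd0]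
  rw [hM]
  field_simp

variable {H : unitaryGroup (Fin 2) ℂ} {β : ℝ} {t d M : ℕ → ℕ}

theorem tendsto_integral_sq_walkLaw_of_isEquivalent_one
    (hd : (fun n => (d n : ℝ)) ~[atTop] fun _ => (1 : ℝ)) :
    Tendsto (fun n => (∫ x, x ^ 2 ∂walkLaw H (d n)) / (d n : ℝ) ^ 2) atTop (𝓝 1) := by
  have hd1 : Tendsto (fun n => (d n : ℝ)) atTop (𝓝 ((1 : ℕ) : ℝ)) := by
    rw [Nat.cast_one]
    exact (Asymptotics.isEquivalent_const_iff_tendsto one_ne_zero).1 hd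
  refine tendsto_const_nhds.congr' ((eventually_eq_of_tendsto_natCast hd1).mono fun n hn => ?_)
  simp [hn, integral_sq_walkLaw_one]

theorem tendsto_charFun_walkLaw_pow_gaussianReal (htdM : ∀ n, t n = d n * M n)
    (ht : Tendsto t atTop atTop) (hβ : β < 1)
    (hd : (fun n => (d n : ℝ)) ~[atTop] fun n => (t n : ℝ) ^ β) {v : NNReal}
    (hv : Tendsto (fun n => (∫ x, x ^ 2 ∂walkLaw H (d n)) / (d n : ℝ) ^ 2) atTop (𝓝 v)) (s : ℝ) :
    Tendsto (fun n => charFun (walkLaw H (d n)) (s / (t n : ℝ) ^ ((1 + β) / 2)) ^ M n) atTop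
      (𝓝 (charFun (gaussianReal 0 v) s)) :=
  have ht' : Tendsto (fun n => (t n : ℝ)) atTop atTop := tendsto_natCast_atTop_atTop.comp ht
  tendsto_charFun_pow_gaussianReal (fun n => ae_abs_le_walkLaw H (d n))
    (fun n => integral_id_walkLaw H (d n))
    (tendsto_div_rpow_of_isEquivalent_rpow ht' hd (by linarith))
    (tendsto_mul_div_rpow_sq (fun n => by exact_mod_cast htdM n) ht' hd hv) s

theorem eventually_eq_one_of_isEquivalent_mul (htdM : ∀ n, t n = d n * M n)
    (ht : Tendsto t atTop atTop)
    (hd : (fun n => (d n : ℝ)) ~[atTop] fun n => (t n : ℝ)) : ∀ᶠ n in atTop, M n = 1 := by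
  have hd0 : ∀ᶠ n in atTop, (d n : ℝ) ≠ 0 := by
    filter_upwards [ht.eventually_ne_atTop 0] with n hn
    exact Nat.cast_ne_zero.2 (left_ne_zero_of_mul (htdM n ▸ hn))
  have hratio : Tendsto (fun n => (t n : ℝ) / d n) atTop (𝓝 ((1 : ℕ) : ℝ)) := by
    rw [Nat.cast_one]
    exact (Asymptotics.isEquivalent_iff_tendsto_one hd0).1 hd.symm
  refine eventually_eq_of_tendsto_natCast (hratio.congr' ?_)
  filter_upwards [hd0] with n hn
  rw [htdM, Nat.cast_mul, mul_div_cancel_left₀ _ hn]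

theorem tendsto_charFun_walkLaw_pow_konnoLaw (h0 : 0 < ‖H.1 0 0‖) (h1 : ‖H.1 0 0‖ < 1)
    (htdM : ∀ n, t n = d n * M n) (ht : Tendsto t atTop atTop)
    (hd : (fun n => (d n : ℝ)) ~[atTop] fun n => (t n : ℝ)) (s : ℝ) :
    Tendsto (fun n => charFun (walkLaw H (d n)) (s / t n) ^ M n) atTop
      (𝓝 (charFun (konnoLaw ‖H.1 0 0‖) s)) := by
  have hM := eventually_eq_one_of_isEquivalent_mul htdM ht hd
  have hdt : t =ᶠ[atTop] d := hM.mono fun n hn => by rw [htdM, hn, mul_one]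
  refine ((tendsto_charFun_walkLaw H h0 h1 s).comp (ht.congr' hdt)).congr' ?_
  filter_upwards [hM, hdt] with n hn hdtn
  rw [Function.comp_apply, hn, pow_one, hdtn]

theorem tendstoInDistribution_of_tendsto_charFun_walkLaw_pow {Ω : ℕ → Type*}
    [∀ n, MeasurableSpace (Ω n)] {P : ∀ n, Measure (Ω n)} [∀ n, IsProbabilityMeasure (P n)]
    {Y : ∀ n, Fin (M n) → Ω n → ℤ} (hmeas : ∀ n i, Measurable (Y n i))
    (hindep : ∀ n, iIndepFun (Y n) (P n))
    (hlaw : ∀ n i x, (P n).real {ω | Y n i ω = x} = walkProb H (d n) x)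
    {X : ∀ n, Ω n → ℤ} (hX : ∀ n ω, X n ω = ∑ i, Y n i ω) {τ : ℕ → ℝ} {ν : Measure ℝ}
    [IsProbabilityMeasure ν]
    (hlim : ∀ s, Tendsto (fun n => charFun (walkLaw H (d n)) (s / τ n) ^ M n) atTop
      (𝓝 (charFun ν s))) :
    TendstoInDistribution (fun n ω => (X n ω : ℝ) / τ n) atTop id P ν := by
  simp only [hX, Int.cast_sum]
  refine tendstoInDistribution_sum_div (fun n i => hasLaw_walkLaw H (hmeas n i) (hlaw n i))
    (fun n => (hindep n).comp (fun _ x => (x : ℝ)) fun _ => by fun_prop) ?_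
  simpa only [Fintype.card_fin] using hlim

end MeasuredWalk

theorem theorem1
    -- the coin, with all four entries nonzero
    (H : Matrix.unitaryGroup (Fin 2) ℂ)
    (hH : H.1 0 0 * H.1 0 1 * H.1 1 0 * H.1 1 1 ≠ 0)
    -- final times `t = d M` tending to infinity, with `d ~ t ^ β`
    (β : ℝ) (t d M : ℕ → ℕ) (htdM : ∀ n, t n = d n * M n) (ht : Tendsto t atTop atTop)
    (hd : (fun n => (d n : ℝ)) ~[atTop] (fun n => (t n : ℝ) ^ β))
    -- for each `n`, independent blocks distributed as the walk after `d n` steps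
    {Ω : ℕ → Type*} [∀ n, MeasurableSpace (Ω n)]
    (P : ∀ n, Measure (Ω n)) [∀ n, IsProbabilityMeasure (P n)]
    (Y : ∀ n, Fin (M n) → Ω n → ℤ) (hmeas : ∀ n i, Measurable (Y n i))
    (hindep : ∀ n, iIndepFun (Y n) (P n))
    (hlaw : ∀ n i x, (P n).real {ω | Y n i ω = x} = walkProb H (d n) x)
    -- the position at the final time
    (X : ∀ n, Ω n → ℤ) (hX : ∀ n ω, X n ω = ∑ i, Y n i ω) :
    (β = 0 →
      TendstoInDistribution (fun n ω => (X n ω : ℝ) / (t n : ℝ) ^ ((1 + β) / 2)) atTop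
        id P (gaussianReal 0 1)) ∧
    (0 < β → β < 1 →
      TendstoInDistribution (fun n ω => (X n ω : ℝ) / (t n : ℝ) ^ ((1 + β) / 2)) atTop
        id P (gaussianReal 0 (Real.toNNReal (1 - √(1 - ‖H.1 0 0‖ ^ 2))))) ∧
    (β = 1 →
      ∃ _ : IsProbabilityMeasure (konnoLaw ‖H.1 0 0‖),
        TendstoInDistribution (fun n ω => (X n ω : ℝ) / (t n : ℝ) ^ ((1 + β) / 2)) atTop
          id P (konnoLaw ‖H.1 0 0‖)) := by
  have h0 : 0 < ‖H.1 0 0‖ := norm_pos_iff.2 fun h => hH (by simp [h])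
  have h1 : ‖H.1 0 0‖ < 1 :=
    norm_lt_one_of_mem_unitaryGroup H.2 zero_ne_one fun h => hH (by simp [h])
  refine ⟨fun hβ => ?_, fun hβ0 hβ1 => ?_, fun hβ => ?_⟩
  · subst hβ
    exact tendstoInDistribution_of_tendsto_charFun_walkLaw_pow hmeas hindep hlaw hX
      (tendsto_charFun_walkLaw_pow_gaussianReal htdM ht one_pos hd
        (tendsto_integral_sq_walkLaw_of_isEquivalent_one (by simpa only [Real.rpow_zero] using hd)))
  · have hd' : Tendsto d atTop atTop := tendsto_natCast_atTop_iff.1 <|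
      hd.symm.tendsto_atTop ((tendsto_rpow_atTop hβ0).comp (tendsto_natCast_atTop_atTop.comp ht))
    have hv : 0 ≤ 1 - √(1 - ‖H.1 0 0‖ ^ 2) :=
      sub_nonneg.2 (Real.sqrt_le_one.2 (sub_le_self _ (sq_nonneg _)))
    refine tendstoInDistribution_of_tendsto_charFun_walkLaw_pow hmeas hindep hlaw hX
      (tendsto_charFun_walkLaw_pow_gaussianReal htdM ht hβ1 hd ?_)
    rw [Real.coe_toNNReal _ hv]
    exact (tendsto_integral_sq_walkLaw H h0 h1).comp hd'
  · subst hβ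
    simp only [add_self_div_two, Real.rpow_one] at hd ⊢
    have hK := isProbabilityMeasure_konnoLaw h0 h1
    exact ⟨hK, tendstoInDistribution_of_tendsto_charFun_walkLaw_pow hmeas hindep hlaw hX
      (tendsto_charFun_walkLaw_pow_konnoLaw h0 h1 htdM ht hd)⟩
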